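/- **Setting.** Let $\Delta\ge 3$, $0\le c\le \Delta-2$, $\kappa=\Delta+c$, and let $V$ be a fixed set of $n$ vertices. A dynamic forest on $V$ starts without edges and undergoes edge insertions (between two different trees) and deletions of existing edges, with all degrees at most $\Delta$ at all times. In the rooted model each tree has a root; an insertion $(p,r)$ makes the root $r$ of a tree a child of a vertex $p$ of another tree, and after deleting an edge from a parent $p$ to its child $r$, the vertex $r$ is a root. The adversary is oblivious: the update sequence is fixed in advance, independently of the random choices. The recourse of an update is the number of edges, present before and after the update, whose color changes. For a vertex $v$, $A(v)$ is the set of colors in $[\kappa]$ on no edge incident to $v$. **DistMaint, rooted version.** *Insertion of $(p,r)$:* color $(p,r)$ with a uniformly random $b\in A(p)$. If some child edge $(r,w)$ has color $b$, recolor it to a uniformly random $a\in A(r)$ and call FixForbidden$(w,b,a)$. *Deletion of $(p,r)$ of color $a$, $p$ the parent of $r$:* let $\ell$ be the number of children of $r$. With probability $(\kappa-\ell)/\kappa$ do nothing more; otherwise choose a uniformly random child $w$ of $r$, let $b$ be the color of $(r,w)$, recolor $(r,w)$ to $a$ and call FixForbidden$(w,b,a)$. *FixForbidden$(v,a,b)$:*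 if no child edge of $v$ has color $b$, return; otherwise let $(v,w)$ be the child edge of color $b$, recolor it to $a$ and call FixForbidden$(w,b,a)$. **DistMaint, unrooted version.** It maintains a rooting of the forest. To insert $(u,v)$, where $T_u,T_v$ are the trees of $u,v$: if both have at most $\Delta$ edges, the endpoint of smaller degree becomes the child; otherwise the endpoint whose tree has fewer edges becomes the child (ties are broken by any fixed deterministic rule, a function of the current rooted forest and the ordered pair $(u,v)$). Reroot the tree of the child at the child and proceed as in the rooted insertion. A deletion is handled as in the rooted version with respect to the current rooting. **Theorem.** The following holds for both versions of DistMaint. 1. (Upper bound.) For every update of every admissible sequence fixed in advance, the expected recourse of that update is at most $$\frac{\Delta}{\kappa}\cdot\min\left\{\frac{\kappa-1}{c},\;2+\lceil\log_{\kappa-1}n\rceil\right\}\quad\text{if } c\ge 1,\qquad 2+\lceil\log_{\Delta-1}n\rceil\quad\text{if } c=0.$$ 2. (Order of magnitude.) There is an absolute constant $C>0$ such that, whenever $n\ge 2\Delta$, the expected recourse of every such update is at most $C\cdot\min\{\Delta/c,\log_{\kappa-1}n\}$, where $\Delta/0=\infty$. 3. (Tightness.) There is an absolute constant $C'>0$ such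 that, for all $\Delta\ge3$, $0\le c\le\Delta-2$ and $n\ge 2\Delta$, there are a height $h$ and an admissible sequence of updates that builds two disjoint complete $(\Delta-1)$-ary trees of height $h$ with roots $r_1\neq r_2$, such that if it is followed by $m$ repetitions of inserting and then deleting the edge $(r_1,r_2)$, the sequence remains admissible, each insertion of $(r_1,r_2)$ has expected recourse at least $C'\cdot\min\{\Delta/c,\log_{\kappa-1}n\}$, and for all sufficiently large $m$ the expected amortized recourse (the expected recourse averaged over all updates of the sequence) is at least $C'\cdot\min\{\Delta/c,\log_{\kappa-1}n\}$. Hence the worst-case expected recourse per update is $\Theta(\min\{\Delta/c,\log_{\kappa-1}n\})$ for $n\ge2\Delta$. -/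

import Mathlib

open scoped ENNReal

namespace DistMaint

noncomputable section

/-! ### Updates and dynamic forests -/

/-- An edge update. In a rooted forest, `insert p r` makes the root `r` a child of `p`, and
`delete p r` deletes the edge between `r` and its parent `p`. In an unrooted forest the order of
the two endpoints carries no meaning. -/
inductive Update (V : Type) : Type
  | insert (u v : V) : Update V
  | delete (u v : V) : Update V

/-- The (unrooted) graph after one update. -/
def applyUpdate {V : Type} (G : SimpleGraph V) : Update V → SimpleGraph V
  | .insert u v => G ⊔ SimpleGraph.edge u v
  | .delete u v => G.deleteEdges {s(u, v)}

/-- The unrooted dynamic forest after a sequence of updates, started from the empty forest. -/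
def forestAfter {V : Type} (us : List (Update V)) : SimpleGraph V :=
  us.foldl applyUpdate ⊥

/-- Number of neighbours of `v` in `G`. -/
def deg {V : Type} (G : SimpleGraph V) (v : V) : ℕ := (G.neighborSet v).ncard

/-- An admissible update of a forest `G` of maximum degree at most `Δ`: an insertion links two
different trees and keeps all degrees at most `Δ`; a deletion removes an existing edge. -/
def LegalUpdate {V : Type} (Δ : ℕ) (G : SimpleGraph V) : Update V → Prop
  | .insert u v => ¬ G.Reachable u v ∧ deg G u < Δ ∧ deg G v < Δ
  | .delete u v => G.Adj u v

/-- An admissible update sequence for an unrooted forest of maximum degree at most `Δ`. -/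
def Legal {V : Type} (Δ : ℕ) (us : List (Update V)) : Prop :=
  ∀ t : Fin us.length, LegalUpdate Δ (forestAfter (us.take t)) (us.get t)

/-- The undirected graph of a rooted forest, which is given by its parent map
(`par v = none` means that `v` is a root). -/
def toGraph {V : Type} (par : V → Option V) : SimpleGraph V :=
  SimpleGraph.fromRel (fun a b => par a = some b)

/-- The rooted forest after one update. -/
def applyRooted {V : Type} [DecidableEq V] (par : V → Option V) : Update V → (V → Option V)
  | .insert p r => Function.update par r (some p)
  | .delete _ r => Function.update par r none

/-- The rooted dynamic forest after a sequence of updates, started from the empty forest, in which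
every vertex is a root. -/
def rootedAfter {V : Type} [DecidableEq V] (us : List (Update V)) : V → Option V :=
  us.foldl applyRooted (fun _ => none)

/-- An admissible update of a rooted forest: an insertion makes a root `r` a child of a vertex `p`
of another tree, keeping all degrees at most `Δ`; a deletion removes the edge between `r` and its
parent `p`, after which `r` is a root. -/
def LegalRootedUpdate {V : Type} (Δ : ℕ) (par : V → Option V) : Update V → Prop
  | .insert p r => par r = none ∧ ¬ (toGraph par).Reachable p r ∧
      deg (toGraph par) p < Δ ∧ deg (toGraph par) r < Δ
  | .delete p r => par r = some p

/-- An admissible update sequence for a rooted forest of maximum degree at most `Δ`. -/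
def LegalRooted {V : Type} [DecidableEq V] (Δ : ℕ) (us : List (Update V)) : Prop :=
  ∀ t : Fin us.length, LegalRootedUpdate Δ (rootedAfter (us.take t)) (us.get t)

/-- The children of `v`. -/
def children {V : Type} [Fintype V] [DecidableEq V] (par : V → Option V) (v : V) : Finset V :=
  Finset.univ.filter (fun w => par w = some v)

/-- The subtree rooted at `v` is a complete `d`-ary tree of height `h`. -/
def IsCompleteTree {V : Type} [Fintype V] [DecidableEq V] (par : V → Option V) (d : ℕ) :
    ℕ → V → Prop
  | 0, v => children par v = ∅
  | h + 1, v => (children par v).card = d ∧ ∀ w ∈ children par v, IsCompleteTree par d h w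

/-! ### The state of the algorithms and the recourse -/

/-- A partial edge coloring with colors in `Fin κ`; pairs that are not edges are uncolored
(`none`). -/
abbrev Coloring (V : Type) (κ : ℕ) : Type := Sym2 V → Option (Fin κ)

/-- The state maintained by the algorithms: a rooting of the forest and an edge coloring. -/
structure State (V : Type) (κ : ℕ) : Type where
  par : V → Option V
  col : Coloring V κ

/-- The empty forest, with the empty coloring. -/
def State.init (V : Type) (κ : ℕ) : State V κ := ⟨fun _ => none, fun _ => none⟩

/-- The set `A(v)` of colors that appear on no edge incident to `v`. -/
def available {V : Type} [Fintype V] {κ : ℕ} (col : Coloring V κ) (v : V) : Finset (Fin κ) :=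
  Finset.univ.filter (fun a => ∀ w, col s(v, w) ≠ some a)

open scoped Classical in
/-- The recourse of an update that changes the state `s` to `s'`: the number of edges, present
before and after, whose color has changed. (Coloring the new edge and removing the deleted edge do
not count.) -/
def recourse {V : Type} [Fintype V] {κ : ℕ} (s s' : State V κ) : ℕ :=
  (Finset.univ.filter (fun e : Sym2 V =>
    s.col e ≠ none ∧ s'.col e ≠ none ∧ s.col e ≠ s'.col e)).card

/-! ### The repair procedures -/

/-- Draw an element uniformly from the finite set `S` and continue with `k`. (For `S = ∅`, which
never occurs in an execution, the value `d` is returned.) -/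
def drawUniform {α β : Type} (S : Finset α) (k : α → PMF β) (d : β) : PMF β :=
  open scoped Classical in
  if h : S.Nonempty then (PMF.uniformOfFinset S h).bind k else PMF.pure d

open scoped Classical in
/-- `FixForbidden(v, a, b)`: the color of the parent edge of `v` has changed from `a` to `b`. If a
child edge `(v, w)` has color `b`, recolor it to `a` and continue with `FixForbidden(w, b, a)`.
The first argument bounds the number of recursive calls; as every call moves one level down, the
number of vertices is always enough. -/
def fixForbidden {V : Type} {κ : ℕ} [DecidableEq V] (par : V → Option V) :
    ℕ → Coloring V κ → V → Fin κ → Fin κ → Coloring V κ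
  | 0, col, _, _, _ => col
  | k + 1, col, v, a, b =>
    if h : ∃ w, par w = some v ∧ col s(v, w) = some b then
      fixForbidden par k (Function.update col s(v, h.choose) (some a)) h.choose b a
    else col

open scoped Classical in
/-- `RootToChild(r, b)`: the root `r` has become a child with parent edge of color `b`. If a child
edge `(r, w)` has color `b`, recolor it to a uniformly random `a ∈ A(r)` and call
`FixForbidden(w, b, a)`. -/
def rootToChild {V : Type} {κ : ℕ} [Fintype V] [DecidableEq V] (s : State V κ) (r : V)
    (b : Fin κ) : PMF (State V κ) :=
  if h : ∃ w, s.par w = some r ∧ s.col s(r, w) = some b then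
    drawUniform (available s.col r)
      (fun a => PMF.pure ⟨s.par, fixForbidden s.par (Fintype.card V)
        (Function.update s.col s(r, h.choose) (some a)) h.choose b a⟩) s
  else PMF.pure s

/-- `ChildToRoot(r, a)`: the child `r` has become a root, its parent edge had color `a`. With
probability `(κ - l) / κ` do nothing, where `l` is the number of children of `r` (realized by a
uniformly random `x` in `{0, ..., κ - 1}` with `l ≤ x`). Otherwise draw a uniformly random child `w`,
recolor `(r, w)` from its color `b` to `a`, and call `FixForbidden(w, b, a)`. -/
def childToRoot {V : Type} {κ : ℕ} [Fintype V] [DecidableEq V] (s : State V κ) (r : V)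
    (a : Fin κ) : PMF (State V κ) :=
  drawUniform (Finset.univ : Finset (Fin κ))
    (fun x =>
      if (children s.par r).card ≤ (x : ℕ) then PMF.pure s
      else drawUniform (children s.par r)
        (fun w => match s.col s(r, w) with
          | some b => PMF.pure ⟨s.par, fixForbidden s.par (Fintype.card V)
              (Function.update s.col s(r, w) (some a)) w b a⟩
          | none => PMF.pure s) s) s

/-! ### The rooted algorithm -/

/-- Insert `(p, r)` with `r` a root, draw its color uniformly from `A(p)`, and call
`RootToChild`. -/
def attach {V : Type} {κ : ℕ} [Fintype V] [DecidableEq V] (s : State V κ) (p r : V) :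
    PMF (State V κ) :=
  drawUniform (available s.col p)
    (fun b => rootToChild
      ⟨Function.update s.par r (some p), Function.update s.col s(p, r) (some b)⟩ r b) s

/-- Delete the edge `(p, r)` between `r` and its parent `p`, and call `ChildToRoot` with its former
color. -/
def detach {V : Type} {κ : ℕ} [Fintype V] [DecidableEq V] (s : State V κ) (p r : V) :
    PMF (State V κ) :=
  match s.col s(p, r) with
  | some a => childToRoot ⟨Function.update s.par r none, Function.update s.col s(p, r) none⟩ r a
  | none => PMF.pure s

/-- One update of the algorithm for rooted forests. -/
def rootedStep {V : Type} {κ : ℕ} [Fintype V] [DecidableEq V] (s : State V κ) :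
    Update V → PMF (State V κ)
  | .insert p r => attach s p r
  | .delete p r => detach s p r

/-! ### The unrooted algorithm -/

open scoped Classical in
/-- Reroot the tree of `v` at `v`: every edge `(y, x)` with `x` the parent of `y` and `y` on the path
from `v` to its root is reversed. -/
def reroot {V : Type} [DecidableEq V] (par : V → Option V) (v : V) : V → Option V := fun x =>
  if x = v then none
  else if h : ∃ y, Relation.ReflTransGen (fun a b => par a = some b) v y ∧ par y = some x then
    some h.choose
  else par x

/-- The number `|E(T_v)|` of edges in the tree of `v`. -/
def treeEdges {V : Type} (G : SimpleGraph V) (v : V) : ℕ :=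
  {e | e ∈ G.edgeSet ∧ ∀ x ∈ e, G.Reachable v x}.ncard

/-- `v` may be made the child when the edge between `u` and `v` is inserted: if both trees have at
most `Δ` edges then `v` has the smaller degree (or there is a tie), and otherwise `v` has the smaller
tree (or there is a tie). -/
def MayBeChild {V : Type} (Δ : ℕ) (G : SimpleGraph V) (u v : V) : Prop :=
  (treeEdges G v ≤ Δ ∧ treeEdges G u ≤ Δ → deg G v ≤ deg G u) ∧
  (¬ (treeEdges G v ≤ Δ ∧ treeEdges G u ≤ Δ) → treeEdges G v ≤ treeEdges G u)

/-- A rule that breaks ties in the choice of the child among `u` and `v`, as a function of the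
current rooted forest: `true` means that `v` is the child. -/
abbrev TieRule (V : Type) : Type := (V → Option V) → V → V → Bool

open scoped Classical in
/-- One update of the algorithm for unrooted forests. -/
def unrootedStep {V : Type} {κ : ℕ} [Fintype V] [DecidableEq V] (Δ : ℕ) (tie : TieRule V)
    (s : State V κ) : Update V → PMF (State V κ)
  | .insert u v =>
    if MayBeChild Δ (toGraph s.par) u v ∧
        (MayBeChild Δ (toGraph s.par) v u → tie s.par u v = true) then
      attach ⟨reroot s.par v, s.col⟩ u v
    else
      attach ⟨reroot s.par u, s.col⟩ v u
  | .delete u v => if s.par v = some u then detach s u v else detach s v u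

/-! ### Expected recourse against an oblivious adversary -/

/-- The law of the state after the algorithm `step` has processed the fixed sequence `us`, started
from the empty forest. -/
def stateLaw {V : Type} {κ : ℕ} (step : State V κ → Update V → PMF (State V κ))
    (us : List (Update V)) : PMF (State V κ) :=
  us.foldl (fun p u => p.bind fun s => step s u) (PMF.pure (State.init V κ))

/-- The expected recourse of the update `u` when it follows the fixed sequence `past`. -/
def expectedRecourse {V : Type} [Fintype V] {κ : ℕ}
    (step : State V κ → Update V → PMF (State V κ)) (past : List (Update V)) (u : Update V) :
    ℝ≥0∞ :=
  ∑' s, stateLaw step past s * ∑' s', step s u s' * (recourse s s' : ℝ≥0∞)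

/-- The expected amortized recourse over the sequence `us`: the average over its updates of their
expected recourse. -/
def amortizedRecourse {V : Type} [Fintype V] {κ : ℕ}
    (step : State V κ → Update V → PMF (State V κ)) (us : List (Update V)) : ℝ≥0∞ :=
  (∑ t : Fin us.length, expectedRecourse step (us.take t) (us.get t)) / (us.length : ℝ≥0∞)

/-! ### The bounds -/

/-- The explicit upper bound, for `κ = Δ + c` colors and `n` vertices. -/
def recourseBound (Δ c n : ℕ) : ℝ :=
  if c = 0 then 2 + (⌈Real.logb ((Δ : ℝ) - 1) n⌉ : ℝ)
  else (Δ : ℝ) / ((Δ : ℝ) + c) *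
    min (((Δ : ℝ) + c - 1) / c) (2 + (⌈Real.logb ((Δ : ℝ) + c - 1) n⌉ : ℝ))

/-- `min {Δ / c, log_{κ - 1} n}` for `κ = Δ + c`, where `Δ / 0 = ∞`. -/
def recourseOrder (Δ c n : ℕ) : ℝ :=
  if c = 0 then Real.logb ((Δ : ℝ) - 1) n
  else min ((Δ : ℝ) / c) (Real.logb ((Δ : ℝ) + c - 1) n)

/-- `m` repetitions of inserting and then deleting the edge between `r₁` and `r₂`. -/
def relink {V : Type} (r₁ r₂ : V) (m : ℕ) : List (Update V) :=
  (List.replicate m [Update.insert r₁ r₂, Update.delete r₁ r₂]).flatten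

end

end DistMaint

open DistMaint

/-!
Both versions of the algorithm keep the edge coloring uniformly distributed among all proper colorings
of the current forest, and this determines the expected recourse of each update exactly.

The repair procedure `fixForbidden` is a Kempe swap: below the vertex `r` whose parent edge appears or
disappears, it exchanges two colors `a` and `b` on the alternating paths that start at `r`
(`kempeSwap`, `fixForbidden_eq`). This swap is an involution on the proper colorings of the forest
without the edge `(p, r)`; it exchanges the colorings that miss `a` at `r` with those that miss `b` at
`r`, and it fixes the colors at `p`. In these terms an insertion draws `b` from `A(p)` and `a` from
`A(r)`, swaps, and gives the new edge the color `b` (`Attachable.expect_attach`). A deletion of an edge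
of color `a` draws `b` from all `κ` colors and swaps (`Attachable.expect_detach`): a random child that
is taken with probability `l / κ` is the same as a random color that may or may not occur below `r`.
Reindexing by the involution (`Attachable.sum_kempeSwap`) turns one into the reverse of the other, and
uniform colorings into uniform colorings (`Attachable.isUniform_attach`,
`Attachable.isUniform_detach`). Uniformity depends only on the graph and not on its rooting, so that it
survives rerooting, and the unrooted version is covered as well.

The recourse is the number of edges on the alternating path. In a uniformly random coloring, the path
reaches a given child of `r` with probability `1 / κ`, and it continues from a vertex `y` to a given
child of `y` with probability `1 / (κ - 1)`, since swaps at `y` show that all colors other than that of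
the edge above `y` are equally likely (`card_chain_step`). If `N i` vertices lie `i + 1` levels below
`r`, the expected recourse of an insertion or deletion is therefore
`κ⁻¹ * ∑ i, N i / (κ - 1) ^ i` (`levelSum`).

The bounds follow from this formula. From `N i ≤ (Δ - 1) ^ (i + 1)` one gets a geometric series, and
together with `∑ i, N i ≤ n` the logarithmic bound (`sum_level_le`). In complete `(Δ - 1)`-ary trees of
the largest height that fits, `N i = (Δ - 1) ^ (i + 1)`, and the sum has the claimed order
(`le_sum_level`). The two trees are symmetric, and the levels below a vertex depend only on the graph
once the vertex is the root (`level_subset_of_toGraph_eq`), so that the choice of the child in the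
unrooted version does not matter.
-/

namespace DistMaint

open Relation

/-! ### Rooted forests -/

section Forest

variable {V : Type}

/-- `up par x y` says that `y` is the parent of `x`. -/
abbrev up (par : V → Option V) (x y : V) : Prop := par x = some y

/-- The parent map `par` has no infinite ascending path, so that it describes a rooted forest. -/
def Grounded (par : V → Option V) : Prop := WellFounded (fun y x => par x = some y)

variable {par : V → Option V}

lemma Grounded.not_transGen (h : Grounded par) (x : V) : ¬ TransGen (up par) x x := by
  induction x using h.induction with
  | _ x ih =>
    intro hx
    obtain ⟨y, hxy, hyx⟩ := TransGen.head'_iff.1 hx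
    exact ih y hxy (TransGen.tail' hyx hxy)

lemma Grounded.ne (h : Grounded par) {x y : V} (hxy : par x = some y) : x ≠ y := by
  rintro rfl
  exact h.not_transGen x (TransGen.single hxy)

lemma Grounded.asymm (h : Grounded par) {x y : V} (hxy : par x = some y) : par y ≠ some x :=
  fun hyx => h.not_transGen x (TransGen.head (r := up par) hxy (TransGen.single hyx))

lemma Grounded.adj_iff (h : Grounded par) {x y : V} :
    (toGraph par).Adj x y ↔ par x = some y ∨ par y = some x := by
  simp only [toGraph, SimpleGraph.fromRel_adj, and_iff_right_iff_imp]
  rintro (h1 | h1)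
  · exact h.ne h1
  · exact (h.ne h1).symm

lemma reachable_of_reflTransGen {x y : V} (h : ReflTransGen (up par) x y) :
    (toGraph par).Reachable x y := by
  induction h with
  | refl => exact SimpleGraph.Reachable.refl _
  | tail _ hyz ih =>
    rename_i y z _
    by_cases hne : y = z
    · exact hne ▸ ih
    · exact ih.trans (SimpleGraph.Adj.reachable
        ((SimpleGraph.fromRel_adj _ _ _).2 ⟨hne, Or.inl hyz⟩))

lemma toGraph_none : toGraph (fun _ : V => none) = ⊥ := by
  ext x y
  simp [toGraph]

lemma grounded_none : Grounded (fun _ : V => none) :=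
  ⟨fun x => ⟨x, fun y hy => by simp at hy⟩⟩

/-- On the path from `v` to its root, every vertex has at most one child. -/
lemma Grounded.path_pred_unique (h : Grounded par) {v x y z : V}
    (hy : ReflTransGen (up par) v y) (hyx : par y = some x)
    (hz : ReflTransGen (up par) v z) (hzx : par z = some x) : y = z := by
  have aux : ∀ {y z : V}, ReflTransGen (up par) y z → par y = some x → par z = some x → y = z := by
    intro y z hyz hyx hzx
    rcases ReflTransGen.cases_head hyz with rfl | ⟨w, hyw, hwz⟩
    · rfl
    · have : w = x := Option.some.inj (hyw.symm.trans hyx)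
      subst this
      exact absurd (TransGen.tail' hwz hzx) (h.not_transGen _)
  have hU : Relator.RightUnique (up par) := fun a b c hab hac =>
    Option.some.inj (hab.symm.trans hac)
  rcases ReflTransGen.total_of_right_unique hU hy hz with h1 | h1
  · exact aux h1 hyx hzx
  · exact (aux h1 hzx hyx).symm

variable [DecidableEq V]

lemma Grounded.update_some (h : Grounded par) {p r : V}
    (hp : ¬ ReflTransGen (up par) p r) : Grounded (Function.update par r (some p)) := by
  have h1 : ∀ x, ¬ ReflTransGen (up par) x r →
      Acc (fun y x => Function.update par r (some p) x = some y) x := by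
    intro x
    induction x using h.induction with
    | _ x ih =>
      intro hx
      refine ⟨x, fun y hy => ?_⟩
      have hxr : x ≠ r := by rintro rfl; exact hx ReflTransGen.refl
      rw [Function.update_of_ne hxr] at hy
      exact ih y hy fun hyr => hx (ReflTransGen.head hy hyr)
  have h2 : Acc (fun y x => Function.update par r (some p) x = some y) r := by
    refine ⟨r, fun y hy => ?_⟩
    rw [Function.update_self] at hy
    obtain rfl := Option.some.inj hy
    exact h1 _ hp
  refine ⟨fun x => ?_⟩
  induction x using h.induction with
  | _ x ih =>
    by_cases hxr : x = r
    · exact hxr ▸ h2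
    · refine ⟨x, fun y hy => ?_⟩
      rw [Function.update_of_ne hxr] at hy
      exact ih y hy

lemma Grounded.update_none (h : Grounded par) (r : V) : Grounded (Function.update par r none) := by
  refine Subrelation.wf ?_ h
  intro y x hyx
  by_cases hxr : x = r
  · subst hxr; simp at hyx
  · rwa [Function.update_of_ne hxr] at hyx

lemma toGraph_update_some {p r : V} (hr : par r = none) (hpr : p ≠ r) :
    toGraph (Function.update par r (some p)) = toGraph par ⊔ SimpleGraph.edge p r := by
  ext x y
  simp only [toGraph, SimpleGraph.fromRel_adj, SimpleGraph.sup_adj, SimpleGraph.edge_adj,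
    Function.update_apply]
  split_ifs <;> grind

lemma toGraph_update_none (h : Grounded par) {p r : V} (hr : par r = some p) :
    toGraph (Function.update par r none) = (toGraph par).deleteEdges {s(p, r)} := by
  ext x y
  have := h.asymm hr
  simp only [toGraph, SimpleGraph.fromRel_adj, SimpleGraph.deleteEdges_adj,
    Function.update_apply, Set.mem_singleton_iff, Sym2.eq_iff]
  split_ifs <;> grind

lemma reroot_self (v : V) : reroot par v v = none := by simp [reroot]

lemma Grounded.reroot_of_path (h : Grounded par) {v x y : V}
    (hx : ReflTransGen (up par) v x) (hxy : par x = some y) : reroot par v y = some x := by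
  have hyv : y ≠ v := by
    rintro rfl
    exact h.not_transGen _ (TransGen.tail' hx hxy)
  have hex : ∃ z, ReflTransGen (fun a b => par a = some b) v z ∧ par z = some y := ⟨x, hx, hxy⟩
  simp only [reroot, if_neg hyv, dif_pos hex]
  exact congrArg some (h.path_pred_unique hex.choose_spec.1 hex.choose_spec.2 hx hxy)

lemma reroot_of_not_path {v x : V} (hx : ¬ ReflTransGen (up par) v x) :
    reroot par v x = par x := by
  have hxv : x ≠ v := by rintro rfl; exact hx ReflTransGen.refl
  have hex : ¬ ∃ z, ReflTransGen (fun a b => par a = some b) v z ∧ par z = some x := by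
    rintro ⟨z, hz, hzx⟩
    exact hx (hz.tail hzx)
  simp only [reroot, if_neg hxv, dif_neg hex]

lemma Grounded.reroot (h : Grounded par) (v : V) : Grounded (reroot par v) := by
  have h1 : ∀ x, ReflTransGen (up par) v x →
      Acc (fun y x => DistMaint.reroot par v x = some y) x := by
    intro x hx
    induction hx with
    | refl => exact ⟨v, fun y hy => by simp [reroot_self] at hy⟩
    | tail hy hyz ih =>
      refine ⟨_, fun w hw => ?_⟩
      rw [h.reroot_of_path hy hyz] at hw
      obtain rfl := Option.some.inj hw
      exact ih
  refine ⟨fun x => ?_⟩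
  induction x using h.induction with
  | _ x ih =>
    by_cases hx : ReflTransGen (up par) v x
    · exact h1 x hx
    · refine ⟨x, fun y hy => ?_⟩
      rw [reroot_of_not_path hx] at hy
      exact ih y hy

lemma Grounded.toGraph_reroot (h : Grounded par) (v : V) :
    toGraph (DistMaint.reroot par v) = toGraph par := by
  have h1 : ∀ {x y}, DistMaint.reroot par v x = some y → par x = some y ∨ par y = some x := by
    intro x y hxy
    by_cases hx : ReflTransGen (up par) v x
    · rcases ReflTransGen.cases_tail hx with rfl | ⟨z, hz, hzx⟩
      · simp [reroot_self] at hxy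
      · rw [h.reroot_of_path hz hzx] at hxy
        obtain rfl := Option.some.inj hxy
        exact Or.inr hzx
    · rw [reroot_of_not_path hx] at hxy
      exact Or.inl hxy
  have h2 : ∀ {x y}, par x = some y →
      DistMaint.reroot par v x = some y ∨ DistMaint.reroot par v y = some x := by
    intro x y hxy
    by_cases hx : ReflTransGen (up par) v x
    · exact Or.inr (h.reroot_of_path hx hxy)
    · exact Or.inl (by rwa [reroot_of_not_path hx])
  ext x y
  rw [h.adj_iff, (h.reroot v).adj_iff]
  constructor
  · rintro (hxy | hxy)
    · exact h1 hxy
    · exact (h1 hxy).symm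
  · rintro (hxy | hxy)
    · exact h2 hxy
    · exact (h2 hxy).symm

variable [Fintype V]

/-- The set of descendants of `v` exactly `i` levels below `v`. -/
def level (par : V → Option V) : ℕ → V → Finset V
  | 0, v => {v}
  | i + 1, v => (children par v).biUnion (level par i)

lemma mem_level_succ {i : ℕ} {v x : V} :
    x ∈ level par (i + 1) v ↔ ∃ y ∈ level par i v, par x = some y := by
  induction i generalizing v with
  | zero => simp [level, children]
  | succ i ih =>
    rw [level]
    simp only [Finset.mem_biUnion, ih]
    rw [level]
    simp only [Finset.mem_biUnion]
    grind

lemma transGen_of_mem_level {i : ℕ} {v x : V} (hx : x ∈ level par (i + 1) v) :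
    TransGen (up par) x v := by
  induction i generalizing x with
  | zero =>
    obtain ⟨y, hy, hxy⟩ := mem_level_succ.1 hx
    rw [level, Finset.mem_singleton] at hy
    exact TransGen.single (hy ▸ hxy)
  | succ i ih =>
    obtain ⟨y, hy, hxy⟩ := mem_level_succ.1 hx
    exact TransGen.head hxy (ih hy)

lemma exists_mem_level {v x : V} (hx : TransGen (up par) x v) :
    ∃ i, x ∈ level par (i + 1) v := by
  induction hx using TransGen.head_induction_on with
  | single h => exact ⟨0, mem_level_succ.2 ⟨v, by simp [level], h⟩⟩
  | head h _ ih =>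
    obtain ⟨i, hi⟩ := ih
    exact ⟨i + 1, mem_level_succ.2 ⟨_, hi, h⟩⟩

lemma Grounded.level_unique (h : Grounded par) {i j : ℕ} {v x : V} (hi : x ∈ level par i v)
    (hj : x ∈ level par j v) : i = j := by
  induction i generalizing x j with
  | zero =>
    obtain rfl : x = v := by simpa [level] using hi
    cases j with
    | zero => rfl
    | succ j => exact absurd (transGen_of_mem_level hj) (h.not_transGen _)
  | succ i ih =>
    cases j with
    | zero =>
      obtain rfl : x = v := by simpa [level] using hj
      exact absurd (transGen_of_mem_level hi) (h.not_transGen _)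
    | succ j =>
      obtain ⟨y, hy, hxy⟩ := mem_level_succ.1 hi
      obtain ⟨z, hz, hxz⟩ := mem_level_succ.1 hj
      obtain rfl : y = z := Option.some.inj (hxy.symm.trans hxz)
      rw [ih hy hz]

lemma Grounded.level_disjoint (h : Grounded par) {i j : ℕ} (hij : i ≠ j) (v : V) :
    Disjoint (level par i v) (level par j v) :=
  Finset.disjoint_left.2 fun _ hi hj => hij (h.level_unique hi hj)

lemma Grounded.sum_card_level_le (h : Grounded par) (v : V) (s : Finset ℕ) :
    ∑ i ∈ s, (level par i v).card ≤ Fintype.card V := by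
  rw [← Finset.card_biUnion fun i _ j _ hij => h.level_disjoint hij v]
  exact Finset.card_le_univ _

lemma level_eq_empty_of_le {i j : ℕ} {v : V} (hij : i ≤ j) (hi : level par i v = ∅) :
    level par j v = ∅ := by
  induction hij with
  | refl => exact hi
  | step _ ih =>
    refine Finset.eq_empty_of_forall_notMem fun x hx => ?_
    obtain ⟨y, hy, -⟩ := mem_level_succ.1 hx
    simp [ih] at hy

/-- The height of a rooted forest is less than its number of vertices. -/
lemma Grounded.level_eq_empty (h : Grounded par) {i : ℕ} (v : V) (hi : Fintype.card V ≤ i) :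
    level par i v = ∅ := by
  by_contra hne
  have h1 : ∀ j ∈ Finset.range (i + 1), 1 ≤ (level par j v).card := by
    intro j hj
    refine Finset.card_pos.2 (Finset.nonempty_iff_ne_empty.2 fun hemp => hne ?_)
    exact level_eq_empty_of_le (Nat.lt_succ_iff.1 (Finset.mem_range.1 hj)) hemp
  have h2 := Finset.sum_le_sum h1
  have h3 := h.sum_card_level_le v (Finset.range (i + 1))
  simp at h2
  omega

lemma card_level_succ_le {d i : ℕ} {v : V}
    (hd : ∀ x ∈ level par i v, (children par x).card ≤ d) :
    (level par (i + 1) v).card ≤ (level par i v).card * d := by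
  have : level par (i + 1) v = (level par i v).biUnion (children par) := by
    ext x
    simp [mem_level_succ, children]
  rw [this]
  exact Finset.card_biUnion_le_card_mul _ _ _ hd

lemma card_level_of_isCompleteTree {d h i : ℕ} {v : V} (hv : IsCompleteTree par d h v)
    (hi : i ≤ h) : (level par i v).card = d ^ i := by
  induction i generalizing v h with
  | zero => simp [level]
  | succ i ih =>
    obtain ⟨h, rfl⟩ : ∃ h', h = h' + 1 := ⟨h - 1, by omega⟩
    obtain ⟨hc, hw⟩ := hv
    rw [level, Finset.card_biUnion, Finset.sum_congr rfl fun w hw' => ih (hw w hw') (by omega)]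
    · simp [hc, pow_succ']
    · intro x hx y hy hxy
      refine Finset.disjoint_left.2 ?_
      intro z hz hz'
      clear ih hw hc
      induction i generalizing z with
      | zero => simp [level] at hz hz'; exact hxy (hz.symm.trans hz')
      | succ i ih =>
        obtain ⟨u, hu, hzu⟩ := mem_level_succ.1 hz
        obtain ⟨u', hu', hzu'⟩ := mem_level_succ.1 hz'
        obtain rfl : u = u' := Option.some.inj (hzu.symm.trans hzu')
        exact ih (by omega) hu hu'

/-- A rooting of a forest is determined, on the tree of `v`, by the choice of `v` as its root. -/
lemma level_subset_of_toGraph_eq {par' : V → Option V} (h : Grounded par) (h' : Grounded par')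
    (hG : toGraph par = toGraph par') {v : V} (hv : par v = none) (hv' : par' v = none) (i : ℕ) :
    level par i v ⊆ level par' i v := by
  suffices H : ∀ x ∈ level par i v, x ∈ level par' i v ∧ par' x = par x from fun x hx => (H x hx).1
  induction i with
  | zero =>
    intro x hx
    obtain rfl : x = v := by simpa [level] using hx
    simp [level, hv, hv']
  | succ i ih =>
    intro x hx
    obtain ⟨y, hy, hxy⟩ := mem_level_succ.1 hx
    obtain ⟨hy', hpy⟩ := ih y hy
    have hadj : (toGraph par').Adj x y := hG ▸ h.adj_iff.2 (Or.inl hxy)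
    have hxy' : par' x = some y := by
      rcases h'.adj_iff.1 hadj with h1 | h1
      · exact h1
      · exact absurd (hpy ▸ h1) (h.asymm hxy)
    exact ⟨mem_level_succ.2 ⟨y, hy', hxy'⟩, hxy'.trans hxy.symm⟩

end Forest

/-! ### Proper colorings and Kempe swaps -/

section Kempe

variable {V : Type} {κ : ℕ} {par : V → Option V} {c : Coloring V κ}

/-- A proper edge coloring of `G`: exactly the edges are colored, and edges with a common endpoint
have different colors. -/
structure IsProper (G : SimpleGraph V) (c : Coloring V κ) : Prop where
  ne_none_iff : ∀ e, c e ≠ none ↔ e ∈ G.edgeSet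
  inj : ∀ v x y, G.Adj v x → G.Adj v y → c s(v, x) = c s(v, y) → x = y

lemma IsProper.eq_none {G : SimpleGraph V} (hc : IsProper G c) {x y : V} (h : ¬ G.Adj x y) :
    c s(x, y) = none := by
  by_contra hne
  exact h ((hc.ne_none_iff _).1 hne)

lemma IsProper.adj {G : SimpleGraph V} (hc : IsProper G c) {x y : V} {d : Fin κ}
    (h : c s(x, y) = some d) : G.Adj x y :=
  (hc.ne_none_iff s(x, y)).1 (by simp [h])

lemma IsProper.exists_color {G : SimpleGraph V} (hc : IsProper G c) {x y : V} (h : G.Adj x y) :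
    ∃ d, c s(x, y) = some d :=
  Option.ne_none_iff_exists'.1 ((hc.ne_none_iff s(x, y)).2 h)

/-- One step of an alternating path towards the root: `y` is the parent of `x`, and the edge between
them has color `a` or `b`. -/
def Step (par : V → Option V) (c : Coloring V κ) (a b : Fin κ) (x y : V) : Prop :=
  par x = some y ∧ (c s(x, y) = some a ∨ c s(x, y) = some b)

/-- The edge `e` lies below `v`, and all edges on the path from `e` up to `v`, including `e` itself,
have color `a` or `b`. -/
def KempeEdge (par : V → Option V) (c : Coloring V κ) (v : V) (a b : Fin κ) (e : Sym2 V) : Prop :=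
  ∃ x y, e = s(x, y) ∧ Step par c a b x y ∧ ReflTransGen (Step par c a b) y v

open scoped Classical in
/-- Exchange the colors `a` and `b` on the alternating paths that start at `v` and go down. -/
noncomputable def kempeSwap (par : V → Option V) (v : V) (a b : Fin κ) (c : Coloring V κ) :
    Coloring V κ :=
  fun e => if KempeEdge par c v a b e then (c e).map (Equiv.swap a b) else c e

lemma up_of_step {a b : Fin κ} {x y : V} (h : ReflTransGen (Step par c a b) x y) :
    ReflTransGen (up par) x y :=
  ReflTransGen.mono (r := Step par c a b) (p := up par) (fun _ _ h => h.1) _ _ h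

lemma step_comm (a b : Fin κ) : Step par c a b = Step par c b a := by
  ext x y
  simp only [Step, or_comm]

lemma kempeEdge_comm (v : V) (a b : Fin κ) : KempeEdge par c v a b = KempeEdge par c v b a := by
  ext e
  simp only [KempeEdge, step_comm]

lemma kempeSwap_comm (v : V) (a b : Fin κ) : kempeSwap par v a b c = kempeSwap par v b a c := by
  ext e : 1
  have h := congrFun (kempeEdge_comm (par := par) (c := c) v a b) e
  by_cases he : KempeEdge par c v b a e
  · rw [kempeSwap, kempeSwap, if_pos he, if_pos (h.symm ▸ he), Equiv.swap_comm]
  · rw [kempeSwap, kempeSwap, if_neg he, if_neg (h.symm ▸ he)]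

lemma KempeEdge.color {v : V} {a b : Fin κ} {e : Sym2 V} (h : KempeEdge par c v a b e) :
    c e = some a ∨ c e = some b := by
  obtain ⟨x, y, rfl, h, -⟩ := h
  exact h.2

lemma map_swap_eq_iff {a b : Fin κ} {o : Option (Fin κ)} :
    (o.map (Equiv.swap a b) = some a ∨ o.map (Equiv.swap a b) = some b) ↔
      (o = some a ∨ o = some b) := by
  cases o with
  | none => simp
  | some d =>
    simp only [Option.map_some, Option.some.injEq, Equiv.swap_apply_def]
    split_ifs <;> grind

lemma kempeSwap_mem_iff {v : V} {a b : Fin κ} (e : Sym2 V) :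
    (kempeSwap par v a b c e = some a ∨ kempeSwap par v a b c e = some b) ↔
      (c e = some a ∨ c e = some b) := by
  rw [kempeSwap]
  split_ifs
  · exact map_swap_eq_iff
  · rfl

lemma step_kempeSwap (v : V) (a b : Fin κ) :
    Step par (kempeSwap par v a b c) a b = Step par c a b := by
  ext x y
  simp only [Step, kempeSwap_mem_iff]

lemma kempeEdge_kempeSwap (v : V) (a b : Fin κ) :
    KempeEdge par (kempeSwap par v a b c) v a b = KempeEdge par c v a b := by
  ext e
  simp only [KempeEdge, step_kempeSwap]

lemma kempeSwap_kempeSwap (v : V) (a b : Fin κ) :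
    kempeSwap par v a b (kempeSwap par v a b c) = c := by
  ext e : 1
  rw [kempeSwap, kempeEdge_kempeSwap]
  split_ifs with h
  · simp only [kempeSwap, if_pos h, Option.map_map, ← Equiv.coe_trans, Equiv.swap_swap]
    simp
  · simp only [kempeSwap, if_neg h]

lemma kempeSwap_eq_none_iff (v : V) (a b : Fin κ) (e : Sym2 V) :
    kempeSwap par v a b c e = none ↔ c e = none := by
  rw [kempeSwap]
  split_ifs <;> simp

/-- Edges that do not lie below `v` keep their color. -/
lemma kempeSwap_of_not_below {v : V} {a b : Fin κ} {e : Sym2 V}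
    (h : ∀ x y, e = s(x, y) → par x = some y → ¬ ReflTransGen (up par) y v) :
    kempeSwap par v a b c e = c e := by
  rw [kempeSwap, if_neg]
  rintro ⟨x, y, rfl, h1, h2⟩
  exact h x y rfl h1.1 (up_of_step h2)

lemma kempeSwap_of_notMem {u v w : V} {a b : Fin κ} (h : ¬ ReflTransGen (up par) u v) :
    kempeSwap par v a b c s(u, w) = c s(u, w) := by
  refine kempeSwap_of_not_below fun x y he hxy hy => h ?_
  rcases Sym2.eq_iff.1 he with ⟨rfl, rfl⟩ | ⟨rfl, rfl⟩
  · exact ReflTransGen.head hxy hy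
  · exact hy

/-- Two `a`-`b`-colored edges with a common endpoint lie on the same alternating path, unless one of
them leads from `v` up to its parent. -/
lemma kempeEdge_of_kempeEdge (hp : Grounded par) {v : V} {a b : Fin κ}
    (hv : ∀ w, par v = some w → c s(v, w) ≠ some a ∧ c s(v, w) ≠ some b) {u x y : V}
    (hx : KempeEdge par c v a b s(u, x)) (hadj : (toGraph par).Adj u y)
    (hy : c s(u, y) = some a ∨ c s(u, y) = some b) : KempeEdge par c v a b s(u, y) := by
  obtain ⟨x', y', he, hs, hr⟩ := hx
  rcases Sym2.eq_iff.1 he with ⟨rfl, rfl⟩ | ⟨rfl, rfl⟩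
  · rcases hp.adj_iff.1 hadj with h | h
    · obtain rfl : x = y := Option.some.inj (hs.1.symm.trans h)
      exact ⟨u, x, rfl, hs, hr⟩
    · exact ⟨y, u, Sym2.eq_swap, ⟨h, by rwa [Sym2.eq_swap]⟩, ReflTransGen.head hs hr⟩
  · rcases hp.adj_iff.1 hadj with h | h
    · rcases ReflTransGen.cases_head hr with rfl | ⟨z, hz, hzv⟩
      · have := hv y h
        tauto
      · obtain rfl : z = y := Option.some.inj (hz.1.symm.trans h)
        exact ⟨u, z, rfl, hz, hzv⟩
    · exact ⟨y, u, Sym2.eq_swap, ⟨h, by rwa [Sym2.eq_swap]⟩, hr⟩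

/-- A Kempe swap at `v` keeps a coloring proper if it does not involve the color of the edge between
`v` and its parent. -/
lemma IsProper.kempeSwap (hp : Grounded par) {G : SimpleGraph V} (hG : G ≤ toGraph par)
    (hc : IsProper G c) {v : V} {a b : Fin κ}
    (hv : ∀ w, par v = some w → c s(v, w) ≠ some a ∧ c s(v, w) ≠ some b) :
    IsProper G (kempeSwap par v a b c) := by
  refine ⟨fun e => ?_, fun u x y hx hy hxy => ?_⟩
  · rw [← hc.ne_none_iff, Ne, kempeSwap_eq_none_iff]
  · have key : ∀ {x y}, G.Adj u y → DistMaint.kempeSwap par v a b c s(u, x) =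
        DistMaint.kempeSwap par v a b c s(u, y) → KempeEdge par c v a b s(u, x) →
        KempeEdge par c v a b s(u, y) := by
      intro x y hy hxy hk
      refine kempeEdge_of_kempeEdge hp hv hk (hG hy) ?_
      rw [← kempeSwap_mem_iff (par := par) (v := v), ← hxy, kempeSwap_mem_iff]
      exact hk.color
    refine hc.inj u x y hx hy ?_
    by_cases hk : KempeEdge par c v a b s(u, x)
    · have hk' := key hy hxy hk
      simp only [DistMaint.kempeSwap, if_pos hk, if_pos hk'] at hxy
      exact Option.map_injective (Equiv.injective _) hxy
    · have hk' : ¬ KempeEdge par c v a b s(u, y) := fun h => hk (key hx hxy.symm h)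
      simpa only [DistMaint.kempeSwap, if_neg hk, if_neg hk'] using hxy

/-- At `v` itself, a Kempe swap exchanges the two colors. -/
lemma kempeSwap_apply_self {G : SimpleGraph V} (hp : Grounded par) (hG : G ≤ toGraph par)
    (hc : IsProper G c) {v : V} {a b : Fin κ}
    (hv : ∀ w, par v = some w → c s(v, w) ≠ some a ∧ c s(v, w) ≠ some b) (w : V) :
    kempeSwap par v a b c s(v, w) = (c s(v, w)).map (Equiv.swap a b) := by
  rw [kempeSwap]
  split_ifs with h
  · rfl
  · cases hcol : c s(v, w) with
    | none => rfl
    | some d =>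
      have hda : d ≠ a ∧ d ≠ b := by
        rcases hp.adj_iff.1 (hG (hc.adj hcol)) with h1 | h1
        · simpa [hcol] using hv w h1
        · by_contra hcon
          refine h ⟨w, v, Sym2.eq_swap, ⟨h1, ?_⟩, ReflTransGen.refl⟩
          rw [Sym2.eq_swap, hcol]
          grind
      simp [Equiv.swap_apply_of_ne_of_ne hda.1 hda.2]

/-- The alternating paths only depend on the part of the forest below `v`. -/
lemma reflTransGen_step_congr {par' : V → Option V} {c' : Coloring V κ} {a b : Fin κ} {v x : V}
    (h : ∀ y z, TransGen (up par) y v → par y = some z →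
      par' y = some z ∧ c' s(y, z) = c s(y, z))
    (hx : ReflTransGen (Step par c a b) x v) : ReflTransGen (Step par' c' a b) x v := by
  induction hx using ReflTransGen.head_induction_on with
  | refl => exact ReflTransGen.refl
  | head hxy hy ih =>
    obtain ⟨h1, h2⟩ := h _ _ (TransGen.head' hxy.1 (up_of_step hy)) hxy.1
    exact ReflTransGen.head ⟨h1, h2 ▸ hxy.2⟩ ih

/-- An alternating path that starts at `v` begins with a child edge of `v`. -/
lemma KempeEdge.exists_child {v : V} {a b : Fin κ} {e : Sym2 V} (h : KempeEdge par c v a b e) :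
    ∃ w, par w = some v ∧ (c s(v, w) = some a ∨ c s(v, w) = some b) ∧
      (e = s(v, w) ∨ KempeEdge par c w a b e) := by
  obtain ⟨x, y, rfl, hs, hr⟩ := h
  rcases ReflTransGen.cases_tail hr with rfl | ⟨z, hz, hzv⟩
  · exact ⟨x, hs.1, by rw [Sym2.eq_swap]; exact hs.2, Or.inl Sym2.eq_swap⟩
  · exact ⟨z, hzv.1, by rw [Sym2.eq_swap]; exact hzv.2, Or.inr ⟨x, y, rfl, hs, hz⟩⟩

/-- A Kempe swap of two colors that are both missing on the child edges of `v` changes nothing. -/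
lemma kempeSwap_eq_self {v : V} {a b : Fin κ} (ha : ∀ w, par w = some v → c s(v, w) ≠ some a)
    (hb : ∀ w, par w = some v → c s(v, w) ≠ some b) : kempeSwap par v a b c = c := by
  ext e : 1
  rw [kempeSwap, if_neg]
  intro he
  obtain ⟨w, hw, hcol, -⟩ := he.exists_child
  exact hcol.elim (ha w hw) (hb w hw)

variable [DecidableEq V]

/-- `FixForbidden` performs a Kempe swap: as `v` has no child edge of color `a`, the alternating paths
that start at `v` form a single path, which begins with the color `b`. The coloring `c` is the one
before the repair; the current coloring `col` has to agree with it only strictly below `v`. The number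
of recursive calls suffices if it is at least the number of vertices below `v`. -/
lemma fixForbidden_eq [Fintype V] (hp : Grounded par)
    (hc : ∀ v x y, (toGraph par).Adj v x → (toGraph par).Adj v y → c s(v, x) = c s(v, y) → x = y)
    {v : V} {a b : Fin κ} {col : Coloring V κ} {k : ℕ}
    (hcol : ∀ x y, par x = some y → TransGen (up par) x v → col s(x, y) = c s(x, y))
    (ha : ∀ x, par x = some v → c s(v, x) ≠ some a)
    (hk : {x | TransGen (up par) x v}.ncard ≤ k) (e : Sym2 V) [Decidable (KempeEdge par c v a b e)] :
    fixForbidden par k col v a b e =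
      if KempeEdge par c v a b e then (c e).map (Equiv.swap a b) else col e := by
  classical
  induction k generalizing v a b col with
  | zero =>
    rw [fixForbidden, if_neg]
    rintro ⟨x, y, rfl, hs, hr⟩
    have hmem : x ∈ {x | TransGen (up par) x v} := TransGen.head' hs.1 (up_of_step hr)
    have := Set.ncard_pos (Set.toFinite _) |>.2 ⟨x, hmem⟩
    omega
  | succ k ih =>
    by_cases hw : ∃ w, par w = some v ∧ col s(v, w) = some b
    · rw [fixForbidden, dif_pos hw]
      obtain ⟨hwv, hwb⟩ := hw.choose_spec
      generalize hw.choose = w at hwv hwb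
      have hcb : c s(v, w) = some b := by
        rw [← hwb, Sym2.eq_swap, hcol w v hwv (TransGen.single hwv)]
      have hK : KempeEdge par c v a b e ↔ e = s(v, w) ∨ KempeEdge par c w b a e := by
        constructor
        · intro h
          obtain ⟨z, hzv, hzc, hz⟩ := h.exists_child
          have hzw : z = w := by
            refine hc v z w (hp.adj_iff.2 (Or.inr hzv)) (hp.adj_iff.2 (Or.inr hwv)) ?_
            rw [hcb]
            exact hzc.resolve_left (ha z hzv)
          rwa [kempeEdge_comm w b a, ← hzw]
        · have hwstep : Step par c a b w v := ⟨hwv, Or.inr (by rwa [Sym2.eq_swap])⟩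
          rintro (rfl | h)
          · exact ⟨w, v, Sym2.eq_swap, hwstep, ReflTransGen.refl⟩
          · rw [kempeEdge_comm] at h
            obtain ⟨x, y, rfl, hs, hr⟩ := h
            exact ⟨x, y, rfl, hs, hr.tail hwstep⟩
      have hvw : ¬ TransGen (up par) v w := fun h => hp.not_transGen v (TransGen.tail h hwv)
      have hne : ∀ x y, par x = some y → TransGen (up par) x w → s(x, y) ≠ s(v, w) := by
        intro x y _ hx he
        rcases Sym2.eq_iff.1 he with ⟨rfl, rfl⟩ | ⟨rfl, rfl⟩
        · exact hvw hx
        · exact hp.not_transGen _ hx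
      rw [ih (v := w) (a := b) (b := a)]
      · by_cases h1 : e = s(v, w)
        · have h2 : ¬ KempeEdge par c w b a e := by
            rintro ⟨x, y, rfl, hs, hr⟩
            exact hne x y hs.1 (TransGen.head' hs.1 (up_of_step hr)) h1
          rw [if_neg h2, if_pos (hK.2 (Or.inl h1)), h1, hcb]
          simp
        · by_cases h2 : KempeEdge par c w b a e
          · rw [if_pos h2, if_pos (hK.2 (Or.inr h2)), Equiv.swap_comm]
          · rw [if_neg h2, if_neg (fun h => (hK.1 h).elim h1 h2), Function.update_of_ne h1]
      · intro x y hxy hx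
        rw [Function.update_of_ne (hne x y hxy hx)]
        exact hcol x y hxy (hx.tail hwv)
      · intro x hx hxb
        have := hc w x v (hp.adj_iff.2 (Or.inr hx)) (hp.adj_iff.2 (Or.inl hwv))
          (by rw [hxb, Sym2.eq_swap, hcb])
        exact hp.asymm hwv (this ▸ hx)
      · have : {x | TransGen (up par) x w}.ncard < {x | TransGen (up par) x v}.ncard := by
          refine Set.ncard_lt_ncard ⟨fun x hx => TransGen.tail hx hwv, fun hsub => ?_⟩
            (Set.toFinite _)
          exact hp.not_transGen w (hsub (TransGen.single hwv))
        omega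
    · rw [fixForbidden, dif_neg hw, if_neg]
      intro h
      obtain ⟨z, hzv, hzc, -⟩ := h.exists_child
      refine hw ⟨z, hzv, ?_⟩
      rw [← hzc.resolve_left (ha z hzv), Sym2.eq_swap, hcol z v hzv (TransGen.single hzv)]

end Kempe

/-! ### Linking two trees -/

section Attach

variable {V : Type} {κ : ℕ} {par : V → Option V} {c : Coloring V κ} {p r : V}

/-- The hypotheses under which the tree with root `r` is attached to `p`. -/
structure Attachable (par : V → Option V) (p r : V) : Prop where
  grounded : Grounded par
  root : par r = none
  not_reachable : ¬ (toGraph par).Reachable p r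

lemma Attachable.ne (h : Attachable par p r) : p ≠ r := by
  rintro rfl
  exact h.not_reachable (SimpleGraph.Reachable.refl _)

lemma Attachable.not_below (h : Attachable par p r) : ¬ ReflTransGen (up par) p r :=
  fun hpr => h.not_reachable (reachable_of_reflTransGen hpr)

lemma Attachable.not_adj (h : Attachable par p r) : ¬ (toGraph par).Adj p r :=
  fun hpr => h.not_reachable hpr.reachable

lemma Attachable.color_eq_none (h : Attachable par p r) (hc : IsProper (toGraph par) c) :
    c s(p, r) = none := hc.eq_none h.not_adj

/-- A root is an ancestor of all vertices of its tree. -/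
lemma reflTransGen_of_reachable {x : V} (hp : Grounded par) (hr : par r = none)
    (hx : (toGraph par).Reachable x r) : ReflTransGen (up par) x r := by
  obtain ⟨w⟩ := hx
  induction w with
  | nil => exact ReflTransGen.refl
  | cons hadj _ ih =>
    specialize ih hr
    rcases hp.adj_iff.1 hadj with h1 | h1
    · exact ReflTransGen.head h1 ih
    · rcases ReflTransGen.cases_head ih with rfl | ⟨z, hz, hzr⟩
      · rw [hr] at h1
        simp at h1
      · obtain rfl := Option.some.inj (hz.symm.trans h1)
        exact hzr

variable [DecidableEq V]

lemma Attachable.grounded_update (h : Attachable par p r) :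
    Grounded (Function.update par r (some p)) :=
  h.grounded.update_some h.not_below

lemma Attachable.up_update_iff (h : Attachable par p r) {x y : V} (hy : y ≠ p) :
    Function.update par r (some p) x = some y ↔ par x = some y := by
  by_cases hx : x = r
  · subst hx
    simp [h.root, hy.symm]
  · rw [Function.update_of_ne hx]

lemma Attachable.step_update (h : Attachable par p r) (hc : IsProper (toGraph par) c) (a b : Fin κ) :
    Step (Function.update par r (some p)) c a b = Step par c a b := by
  ext x y
  by_cases hx : x = r
  · subst hx
    simp only [Step, Function.update_self, h.root]
    constructor
    · rintro ⟨h1, h2⟩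
      obtain rfl := Option.some.inj h1
      rw [Sym2.eq_swap, h.color_eq_none hc] at h2
      simp at h2
    · rintro ⟨h1, -⟩
      simp at h1
  · simp only [Step, Function.update_of_ne hx]

lemma Attachable.kempeEdge_update (h : Attachable par p r) (hc : IsProper (toGraph par) c) (v : V)
    (a b : Fin κ) :
    KempeEdge (Function.update par r (some p)) c v a b = KempeEdge par c v a b := by
  ext e
  simp only [KempeEdge, h.step_update hc]

/-- A proper coloring of the forest without the edge between `p` and `r`, which leaves this edge
uncolored, is still injective at every vertex of the forest with that edge. -/
lemma Attachable.inj_update (h : Attachable par p r) (hc : IsProper (toGraph par) c) (v x y : V)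
    (hx : (toGraph (Function.update par r (some p))).Adj v x)
    (hy : (toGraph (Function.update par r (some p))).Adj v y)
    (hxy : c s(v, x) = c s(v, y)) : x = y := by
  rw [toGraph_update_some h.root h.ne, SimpleGraph.sup_adj] at hx hy
  by_cases hx' : (toGraph par).Adj v x
  · obtain ⟨d, hd⟩ := hc.exists_color hx'
    exact hc.inj v x y hx' (hc.adj (hxy ▸ hd)) hxy
  · have hy' : ¬ (toGraph par).Adj v y := by
      intro hy'
      obtain ⟨d, hd⟩ := hc.exists_color hy'
      exact hx' (hc.adj (hxy ▸ hd))
    have h1 := hx.resolve_left hx'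
    have h2 := hy.resolve_left hy'
    rw [SimpleGraph.edge_adj] at h1 h2
    grind

lemma attachable_update_none (hp : Grounded par) (hr : par r = some p) :
    Attachable (Function.update par r none) p r := by
  refine ⟨hp.update_none r, by simp, fun h => ?_⟩
  have h1 := reflTransGen_of_reachable (hp.update_none r) (by simp) h
  have h2 : ReflTransGen (up par) p r := by
    refine ReflTransGen.mono (r := up (Function.update par r none)) (fun x y hxy => ?_) _ _ h1
    by_cases hxr : x = r
    · subst hxr
      simp [up] at hxy
    · simpa only [up, Function.update_of_ne hxr] using hxy
  exact hp.not_transGen r (TransGen.head' hr h2)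

lemma IsProper.update_some {G : SimpleGraph V} (hc : IsProper G c) (hpr : p ≠ r)
    {b : Fin κ} (hp : ∀ w, c s(p, w) ≠ some b) (hr : ∀ w, c s(r, w) ≠ some b) :
    IsProper (G ⊔ SimpleGraph.edge p r) (Function.update c s(p, r) (some b)) := by
  have hb : ∀ v w w', s(v, w) = s(p, r) → c s(v, w') ≠ some b := by
    intro v w w' he
    rcases Sym2.eq_iff.1 he with ⟨rfl, -⟩ | ⟨rfl, -⟩
    · exact hp w'
    · exact hr w'
  have hadj : ∀ v w, s(v, w) ≠ s(p, r) → (G ⊔ SimpleGraph.edge p r).Adj v w → G.Adj v w := by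
    intro v w hne hvw
    rw [SimpleGraph.sup_adj, SimpleGraph.edge_adj] at hvw
    rcases hvw with hvw | ⟨hvw, -⟩
    · exact hvw
    · exact absurd (Sym2.eq_iff.2 hvw) hne
  refine ⟨fun e => ?_, fun v x y hx hy hxy => ?_⟩
  · by_cases he : e = s(p, r)
    · subst he
      simp [hpr]
    · rw [Function.update_of_ne he, hc.ne_none_iff]
      induction e with
      | _ x y =>
        simp only [SimpleGraph.mem_edgeSet]
        exact ⟨fun hxy => Or.inl hxy, hadj x y he⟩
  · by_cases h1 : s(v, x) = s(p, r) <;> by_cases h2 : s(v, y) = s(p, r)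
    · exact Sym2.congr_right.1 (h1.trans h2.symm)
    · rw [h1, Function.update_self, Function.update_of_ne h2] at hxy
      exact absurd hxy.symm (hb v x y h1)
    · rw [h2, Function.update_self, Function.update_of_ne h1] at hxy
      exact absurd hxy (hb v y x h2)
    · rw [Function.update_of_ne h1, Function.update_of_ne h2] at hxy
      exact hc.inj v x y (hadj v x h1 hx) (hadj v y h2 hy) hxy

lemma IsProper.update_none {G : SimpleGraph V} (hpr : ¬ G.Adj p r)
    (hc : IsProper (G ⊔ SimpleGraph.edge p r) c) :
    IsProper G (Function.update c s(p, r) none) := by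
  have hne : ∀ v w, G.Adj v w → s(v, w) ≠ s(p, r) := by
    intro v w hvw he
    rcases Sym2.eq_iff.1 he with ⟨rfl, rfl⟩ | ⟨rfl, rfl⟩
    · exact hpr hvw
    · exact hpr hvw.symm
  refine ⟨fun e => ?_, fun v x y hx hy hxy => ?_⟩
  · by_cases he : e = s(p, r)
    · subst he
      simp [hpr]
    · rw [Function.update_of_ne he, hc.ne_none_iff]
      induction e with
      | _ x y =>
        simp only [SimpleGraph.mem_edgeSet, SimpleGraph.sup_adj, SimpleGraph.edge_adj,
          or_iff_left_iff_imp]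
        exact fun h => absurd (Sym2.eq_iff.2 h.1) he
  · rw [Function.update_of_ne (hne v x hx), Function.update_of_ne (hne v y hy)] at hxy
    exact hc.inj v x y (Or.inl hx) (Or.inl hy) hxy

lemma IsProper.update_none_ne {G : SimpleGraph V} (hc : IsProper G c) (hpr : G.Adj p r)
    {v w w' : V} (hv : s(v, w') = s(p, r)) {a : Fin κ} (ha : c s(p, r) = some a) :
    Function.update c s(p, r) none s(v, w) ≠ some a := by
  by_cases he : s(v, w) = s(p, r)
  · simp [he]
  · rw [Function.update_of_ne he]
    intro h
    have hv' : G.Adj v w' := by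
      rw [← SimpleGraph.mem_edgeSet, hv]
      exact hpr
    have := hc.inj v w w' (hc.adj h) hv' (by rw [h, hv, ha])
    exact he (this ▸ hv)

end Attach

/-! ### Expectations over the random choices of one update -/

section Expectation

variable {α β : Type}

/-- The expectation of `f` under the law `p`. -/
noncomputable def expect (p : PMF α) (f : α → ℝ≥0∞) : ℝ≥0∞ := ∑' a, p a * f a

lemma expect_pure (a : α) (f : α → ℝ≥0∞) : expect (PMF.pure a) f = f a := by
  rw [expect, tsum_eq_single a]
  · simp
  · intro b hb
    simp [PMF.pure_apply, hb]

lemma expect_bind (p : PMF α) (k : α → PMF β) (f : β → ℝ≥0∞) :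
    expect (p.bind k) f = expect p fun a => expect (k a) f := by
  simp only [expect, PMF.bind_apply, ← ENNReal.tsum_mul_right, ← ENNReal.tsum_mul_left]
  rw [ENNReal.tsum_comm]
  simp only [mul_assoc]

lemma expect_one (p : PMF α) : expect p (fun _ => 1) = 1 := by
  simp [expect, p.tsum_coe]

lemma expect_uniformOfFinset (S : Finset α) (h : S.Nonempty) (f : α → ℝ≥0∞) :
    expect (PMF.uniformOfFinset S h) f = (S.card : ℝ≥0∞)⁻¹ * ∑ s ∈ S, f s := by
  rw [expect, tsum_eq_sum (s := S), Finset.mul_sum]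
  · refine Finset.sum_congr rfl fun s hs => ?_
    rw [PMF.uniformOfFinset_apply_of_mem h hs]
  · intro s hs
    rw [PMF.uniformOfFinset_apply_of_notMem h hs, zero_mul]

lemma expect_drawUniform {S : Finset α} (h : S.Nonempty) (k : α → PMF β) (d : β)
    (f : β → ℝ≥0∞) :
    expect (drawUniform S k d) f = (S.card : ℝ≥0∞)⁻¹ * ∑ s ∈ S, expect (k s) f := by
  rw [drawUniform, dif_pos h, expect_bind, expect_uniformOfFinset]

lemma inv_card_mul_sum_const {S : Finset α} (h : S.Nonempty) (x : ℝ≥0∞) :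
    (S.card : ℝ≥0∞)⁻¹ * ∑ _s ∈ S, x = x := by
  rw [Finset.sum_const, nsmul_eq_mul, ← mul_assoc, ENNReal.inv_mul_cancel, one_mul]
  · simpa using h.ne_empty
  · exact ENNReal.natCast_ne_top _

end Expectation

section OneUpdate

variable {V : Type} [Fintype V] {κ : ℕ} {par : V → Option V} {c : Coloring V κ}

lemma mem_available {v : V} {a : Fin κ} : a ∈ available c v ↔ ∀ w, c s(v, w) ≠ some a := by
  simp [available]

/-- In a proper coloring, every edge at `v` takes one color away from `A(v)`. -/
lemma card_available {G : SimpleGraph V} (hc : IsProper G c) (v : V) :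
    (available c v).card = κ - deg G v := by
  classical
  have h1 : ((available c v)ᶜ).card = deg G v := by
    rw [deg, ← Set.ncard_coe_finset]
    symm
    refine Set.ncard_congr (fun w (hw : w ∈ G.neighborSet v) => (hc.exists_color hw).choose)
      ?_ ?_ ?_
    · intro w hw
      have := (hc.exists_color hw).choose_spec
      simp only [Finset.mem_coe, Finset.mem_compl, mem_available, not_forall, not_not]
      exact ⟨w, this⟩
    · intro w w' hw hw' h
      refine hc.inj v w w' hw hw' ?_
      rw [(hc.exists_color hw).choose_spec, (hc.exists_color hw').choose_spec]
      exact congrArg some h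
    · intro a ha
      simp only [Finset.mem_coe, Finset.mem_compl, mem_available, not_forall, not_not] at ha
      obtain ⟨w, hw⟩ := ha
      refine ⟨w, hc.adj hw, Option.some.inj ?_⟩
      rw [← (hc.exists_color (hc.adj hw)).choose_spec, hw]
  have h2 := Finset.card_compl (available c v)
  have h3 := Finset.card_le_univ (available c v)
  simp only [Fintype.card_fin] at h2 h3
  omega

lemma available_nonempty {G : SimpleGraph V} (hc : IsProper G c) {v : V} (hv : deg G v < κ) :
    (available c v).Nonempty := by
  rw [← Finset.card_pos, card_available hc]
  omega

variable [DecidableEq V] {p r : V}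

/-- The expectation over the random choices of one insertion. If the color `b` of the new edge is
missing at `r`, then the swap is trivial, and the color `a` may be drawn nevertheless. -/
lemma Attachable.expect_attach (h : Attachable par p r) (hc : IsProper (toGraph par) c)
    (hp : (available c p).Nonempty)
    (hr : (available c r).Nonempty) (f : State V κ → ℝ≥0∞) :
    expect (attach ⟨par, c⟩ p r) f = ((available c p).card : ℝ≥0∞)⁻¹ * ∑ b ∈ available c p,
      ((available c r).card : ℝ≥0∞)⁻¹ * ∑ a ∈ available c r,
        f ⟨Function.update par r (some p),
          Function.update (kempeSwap par r a b c) s(p, r) (some b)⟩ := by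
  classical
  rw [attach, expect_drawUniform hp]
  refine congrArg _ (Finset.sum_congr rfl fun b hb => ?_)
  have hne : ∀ w, par w = some r → s(r, w) ≠ s(p, r) := by
    intro w hw he
    rw [Sym2.eq_swap, Sym2.eq_iff] at he
    rcases he with ⟨rfl, -⟩ | ⟨h1, h2⟩
    · exact h.not_below (ReflTransGen.single hw)
    · exact h.ne h2.symm
  rw [rootToChild]
  dsimp only
  split_ifs with hw
  · have hav : available (Function.update c s(p, r) (some b)) r = available c r := by
      obtain ⟨w, hw1, hw2⟩ := hw
      rw [h.up_update_iff h.ne.symm] at hw1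
      rw [Function.update_of_ne (hne w hw1)] at hw2
      ext d
      simp only [mem_available]
      refine ⟨fun hd z hz => ?_, fun hd z hz => ?_⟩
      · refine hd z ?_
        rw [Function.update_of_ne, hz]
        intro he
        rw [he, h.color_eq_none hc] at hz
        simp at hz
      · by_cases he : s(r, z) = s(p, r)
        · rw [he, Function.update_self] at hz
          exact hd w (hw2.trans hz)
        · rw [Function.update_of_ne he] at hz
          exact hd z hz
    rw [hav, expect_drawUniform hr]
    refine congrArg _ (Finset.sum_congr rfl fun a ha => ?_)
    rw [expect_pure]
    have hfix : fixForbidden (Function.update par r (some p)) (Fintype.card V + 1)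
        (Function.update c s(p, r) (some b)) r a b =
        Function.update (kempeSwap par r a b c) s(p, r) (some b) := by
      ext e : 1
      rw [fixForbidden_eq (c := c) h.grounded_update (h.inj_update hc)]
      · rw [h.kempeEdge_update hc]
        by_cases he : e = s(p, r)
        · subst he
          rw [if_neg, Function.update_self, Function.update_self]
          intro hk
          simpa [h.color_eq_none hc] using hk.color
        · rw [Function.update_of_ne he, Function.update_of_ne he, kempeSwap]
      · intro x y hxy hx
        rw [Function.update_of_ne]
        intro he
        rcases Sym2.eq_iff.1 he with ⟨rfl, rfl⟩ | ⟨rfl, rfl⟩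
        · exact h.grounded_update.asymm hxy (by simp)
        · exact h.grounded_update.not_transGen _ hx
      · intro x _
        exact mem_available.1 ha x
      · exact (Set.ncard_le_card _).trans (by simp)
    rw [← hfix, fixForbidden, dif_pos hw]
  · rw [expect_pure]
    have hs : ∀ a ∈ available c r, kempeSwap par r a b c = c := by
      intro a ha
      refine kempeSwap_eq_self (fun w _ => mem_available.1 ha w) fun w hwr hwb => hw ⟨w, ?_, ?_⟩
      · rwa [h.up_update_iff h.ne.symm]
      · rwa [Function.update_of_ne (hne w hwr)]
    rw [Finset.sum_congr rfl fun a ha => by rw [hs a ha], inv_card_mul_sum_const hr]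

/-- The expectation over the random choices of one deletion. Drawing a uniformly random child with
probability `l / κ` amounts to drawing a uniformly random color `b` and, if it is the color of a child
edge of `r`, taking that child. -/
lemma Attachable.expect_detach (h : Attachable par p r)
    (hc : IsProper (toGraph par) (Function.update c s(p, r) none))
    {a : Fin κ} (ha : c s(p, r) = some a)
    (har : ∀ w, Function.update c s(p, r) none s(r, w) ≠ some a) (f : State V κ → ℝ≥0∞) :
    expect (detach ⟨Function.update par r (some p), c⟩ p r) f =
      (κ : ℝ≥0∞)⁻¹ * ∑ b, f ⟨par, kempeSwap par r a b (Function.update c s(p, r) none)⟩ := by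
  classical
  have hpar : Function.update (Function.update par r (some p)) r none = par := by
    rw [Function.update_idem, ← h.root, Function.update_eq_self]
  have hκ : (Finset.univ : Finset (Fin κ)).Nonempty := ⟨a, Finset.mem_univ _⟩
  rw [detach]
  simp only [ha, hpar]
  generalize Function.update c s(p, r) none = c at hc har
  rw [childToRoot, expect_drawUniform hκ, Finset.card_univ, Fintype.card_fin]
  refine congrArg _ ?_
  dsimp only
  -- the colors of the child edges
  set ψ : V → Fin κ := fun w => (c s(r, w)).getD a with hψ
  have hψc : ∀ w ∈ children par r, c s(r, w) = some (ψ w) := by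
    intro w hw
    obtain ⟨d, hd⟩ := hc.exists_color (h.grounded.adj_iff.2 (Or.inr (by simpa [children] using hw)))
    simp [hψ, hd]
  have hinj : Set.InjOn ψ (children par r) := by
    intro w hw w' hw' hww
    have h1 := hψc w hw
    have h2 := hψc w' hw'
    exact hc.inj r w w' (hc.adj h1) (hc.adj h2) (by rw [h1, h2, hww])
  have hcard : (children par r).card ≤ κ := by
    rw [← Finset.card_image_of_injOn hinj]
    exact (Finset.card_le_univ _).trans (by simp)
  have hF : ∀ w ∈ children par r, fixForbidden par (Fintype.card V)
      (Function.update c s(r, w) (some a)) w (ψ w) a = kempeSwap par r a (ψ w) c := by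
    intro w hw
    have hcol := hψc w hw
    have hwr : par w = some r := by simpa [children] using hw
    have hfix : fixForbidden par (Fintype.card V + 1) c r a (ψ w) = kempeSwap par r a (ψ w) c := by
      ext e : 1
      rw [fixForbidden_eq (c := c) h.grounded hc.inj (fun _ _ _ _ => rfl) (fun x _ => har x)
        ((Set.ncard_le_card _).trans (by simp)), kempeSwap]
    have hex : ∃ z, par z = some r ∧ c s(r, z) = some (ψ w) := ⟨w, hwr, hcol⟩
    have hchoose : hex.choose = w := by
      have h1 := hex.choose_spec.2
      exact hc.inj r _ _ (hc.adj h1) (hc.adj hcol) (h1.trans hcol.symm)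
    rw [← hfix, fixForbidden, dif_pos hex, hchoose]
  have hrest : ∀ b ∈ ((children par r).image ψ)ᶜ, f ⟨par, kempeSwap par r a b c⟩ = f ⟨par, c⟩ := by
    intro b hb
    rw [kempeSwap_eq_self (fun w _ => har w)]
    intro w hw hcol
    refine Finset.mem_compl.1 hb (Finset.mem_image.2 ⟨w, by simpa [children] using hw, ?_⟩)
    simp [hψ, hcol]
  have hsum : ∑ b, f ⟨par, kempeSwap par r a b c⟩ =
      ∑ w ∈ children par r, f ⟨par, kempeSwap par r a (ψ w) c⟩ +
        (κ - (children par r).card) • f ⟨par, c⟩ := by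
    rw [← Finset.sum_add_sum_compl ((children par r).image ψ), Finset.sum_image hinj,
      Finset.sum_congr rfl hrest, Finset.sum_const, Finset.card_compl,
      Finset.card_image_of_injOn hinj, Fintype.card_fin]
  rw [hsum, Finset.sum_congr rfl fun x _ => apply_ite (fun q => expect q f) _ _ _, Finset.sum_ite,
    Finset.sum_const, Finset.sum_const, expect_pure, add_comm]
  have hlt : (Finset.univ.filter fun x : Fin κ => ¬ (children par r).card ≤ (x : ℕ)).card =
      (children par r).card := by
    simp only [not_le]
    rw [Fin.card_filter_val_lt]
    omega
  have hle : (Finset.univ.filter fun x : Fin κ => (children par r).card ≤ (x : ℕ)).card =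
      κ - (children par r).card := by
    have := Finset.card_filter_add_card_filter_not (s := (Finset.univ : Finset (Fin κ)))
      (fun x : Fin κ => (children par r).card ≤ (x : ℕ))
    rw [hlt, Finset.card_univ, Fintype.card_fin] at this
    omega
  rw [hlt, hle]
  congr 1
  rcases (children par r).eq_empty_or_nonempty with hemp | hne
  · simp [hemp]
  · rw [expect_drawUniform hne, nsmul_eq_mul, ← mul_assoc, ENNReal.mul_inv_cancel, one_mul]
    · refine Finset.sum_congr rfl fun w hw => ?_
      simp only [hψc w hw]
      rw [expect_pure, hF w hw]
    · simpa using hne.ne_empty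
    · exact ENNReal.natCast_ne_top _

end OneUpdate

/-! ### Uniformly random proper colorings -/

section Uniform

variable {V : Type} {κ : ℕ} {par : V → Option V} {c : Coloring V κ} {p r : V}

lemma Attachable.color_above_ne (h : Attachable par p r) (a : Fin κ) (w : V)
    (hw : par r = some w) : c s(r, w) ≠ some a := by
  simp [h.root] at hw

lemma Attachable.isProper_kempeSwap (h : Attachable par p r) (hc : IsProper (toGraph par) c)
    (a b : Fin κ) : IsProper (toGraph par) (kempeSwap par r a b c) :=
  hc.kempeSwap h.grounded le_rfl fun w hw => ⟨h.color_above_ne a w hw, h.color_above_ne b w hw⟩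

lemma sum_available_comm (F : Coloring V κ → Fin κ → Fin κ → ℝ≥0∞) (S : Finset (Coloring V κ))
    (A B : Coloring V κ → Finset (Fin κ)) :
    ∑ c ∈ S, ∑ b ∈ A c, ∑ a ∈ B c, F c a b =
      ∑ b, ∑ a, ∑ c ∈ S with b ∈ A c ∧ a ∈ B c, F c a b := by
  rw [Finset.sum_comm' (t' := Finset.univ) (s' := fun b => S.filter fun c => b ∈ A c) (by simp)]
  refine Finset.sum_congr rfl fun b _ => ?_
  rw [Finset.sum_comm' (t' := Finset.univ)
    (s' := fun a => S.filter fun c => b ∈ A c ∧ a ∈ B c) (by simp [and_assoc])]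

variable [Fintype V]

lemma Attachable.available_parent (h : Attachable par p r) (a b : Fin κ) :
    available (kempeSwap par r a b c) p = available c p := by
  ext d
  simp only [mem_available, kempeSwap_of_notMem h.not_below]

lemma Attachable.mem_available_root (h : Attachable par p r) (hc : IsProper (toGraph par) c)
    (a b d : Fin κ) :
    d ∈ available (kempeSwap par r a b c) r ↔ Equiv.swap a b d ∈ available c r := by
  simp only [mem_available]
  refine forall_congr' fun w => not_congr ?_
  rw [kempeSwap_apply_self h.grounded le_rfl hc fun w hw =>
    ⟨h.color_above_ne a w hw, h.color_above_ne b w hw⟩]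
  cases c s(r, w) with
  | none => simp
  | some x => simp [Equiv.swap_apply_eq_iff]

variable [DecidableEq V]

open scoped Classical in
/-- The set of proper edge colorings of `G` with `κ` colors. -/
noncomputable def properColorings (κ : ℕ) (G : SimpleGraph V) : Finset (Coloring V κ) :=
  Finset.univ.filter (IsProper G)

lemma mem_properColorings {G : SimpleGraph V} : c ∈ properColorings κ G ↔ IsProper G c := by
  simp [properColorings]

/-- The law `μ` is that of a uniformly random proper coloring of the forest with parent map `par`. -/
def IsUniform (μ : PMF (State V κ)) (par : V → Option V) : Prop :=
  ∀ f, expect μ f = ((properColorings κ (toGraph par)).card : ℝ≥0∞)⁻¹ *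
    ∑ c ∈ properColorings κ (toGraph par), f ⟨par, c⟩

lemma IsUniform.nonempty {μ : PMF (State V κ)} (hμ : IsUniform μ par) :
    (properColorings κ (toGraph par)).Nonempty := by
  by_contra h
  have h1 := hμ fun _ => 1
  rw [expect_one, Finset.not_nonempty_iff_eq_empty.1 h] at h1
  simp at h1

lemma isUniform_of_const {μ : PMF (State V κ)} {K : ℝ≥0∞}
    (h : ∀ f, expect μ f = K * ∑ c ∈ properColorings κ (toGraph par), f ⟨par, c⟩) :
    IsUniform μ par := by
  have h1 := h fun _ => 1
  rw [expect_one, Finset.sum_const, nsmul_eq_mul, mul_one] at h1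
  intro f
  rw [h f, ENNReal.eq_inv_of_mul_eq_one_left h1.symm]

lemma isUniform_init : IsUniform (PMF.pure (State.init V κ)) fun _ => none := by
  have h : properColorings κ (toGraph fun _ : V => none) = {fun _ => none} := by
    ext c
    rw [mem_properColorings, toGraph_none, Finset.mem_singleton]
    constructor
    · intro hc
      ext e : 1
      by_contra hne
      simpa using (hc.ne_none_iff e).1 hne
    · rintro rfl
      exact ⟨by simp, by simp⟩
  intro f
  rw [expect_pure, h]
  simp [State.init]

/-- A proper coloring of the forest with the edge between `p` and `r` consists of a proper coloring
of the forest without it and a color that is missing at `p` and at `r`. -/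
lemma Attachable.sum_extend (h : Attachable par p r) (F : Coloring V κ → ℝ≥0∞) :
    ∑ c ∈ properColorings κ (toGraph par), ∑ b ∈ available c p ∩ available c r,
        F (Function.update c s(p, r) (some b)) =
      ∑ c ∈ properColorings κ (toGraph (Function.update par r (some p))), F c := by
  rw [toGraph_update_some h.root h.ne, Finset.sum_sigma']
  refine Finset.sum_bij (fun x _ => Function.update x.1 s(p, r) (some x.2)) ?_ ?_ ?_ ?_
  · rintro ⟨c, b⟩ hx
    simp only [Finset.mem_sigma, Finset.mem_inter, mem_available, mem_properColorings] at hx ⊢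
    exact hx.1.update_some h.ne hx.2.1 hx.2.2
  · rintro ⟨c, b⟩ hx ⟨c', b'⟩ hx' he
    simp only [Finset.mem_sigma, mem_properColorings] at hx hx'
    have hc : c = c' := by
      ext e : 1
      by_cases hepr : e = s(p, r)
      · rw [hepr, h.color_eq_none hx.1, h.color_eq_none hx'.1]
      · simpa [Function.update_of_ne hepr] using congrFun he e
    have hb : b = b' := by simpa using congrFun he s(p, r)
    rw [hc, hb]
  · intro c' hc'
    rw [mem_properColorings] at hc'
    have hadj : (toGraph par ⊔ SimpleGraph.edge p r).Adj p r := by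
      simp [SimpleGraph.edge_adj, h.ne]
    obtain ⟨b, hb⟩ := hc'.exists_color hadj
    refine ⟨⟨Function.update c' s(p, r) none, b⟩, ?_, ?_⟩
    · simp only [Finset.mem_sigma, Finset.mem_inter, mem_available, mem_properColorings]
      exact ⟨hc'.update_none h.not_adj, fun w => hc'.update_none_ne hadj rfl hb,
        fun w => hc'.update_none_ne hadj Sym2.eq_swap hb⟩
    · simp [← hb]
  · intro _ _
    rfl

/-- The exchange identity behind the invariance of the uniform distribution: the Kempe swap at `r` is
a bijection between the colorings that miss `a` at `r` and those that miss `b` at `r`. -/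
lemma Attachable.sum_kempeSwap (h : Attachable par p r)
    (H : Coloring V κ → Fin κ → Fin κ → ℝ≥0∞) :
    ∑ c ∈ properColorings κ (toGraph par), ∑ b ∈ available c p, ∑ a ∈ available c r,
        H (kempeSwap par r a b c) a b =
      ∑ c ∈ properColorings κ (toGraph par), ∑ b ∈ available c p ∩ available c r,
        ∑ a, H c a b := by
  rw [sum_available_comm (fun c a b => H (kempeSwap par r a b c) a b),
    sum_available_comm (fun c a b => H c a b) _ (fun c => available c p ∩ available c r)
      (fun _ => Finset.univ)]
  refine Finset.sum_congr rfl fun b _ => Finset.sum_congr rfl fun a _ => ?_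
  refine Finset.sum_nbij' (kempeSwap par r a b) (kempeSwap par r a b) ?_ ?_ ?_ ?_ ?_
  · intro c hc
    simp only [Finset.mem_filter, mem_properColorings, Finset.mem_inter, Finset.mem_univ,
      and_true] at hc ⊢
    refine ⟨h.isProper_kempeSwap hc.1 a b, ?_, ?_⟩
    · rw [h.available_parent]
      exact hc.2.1
    · rw [h.mem_available_root hc.1, Equiv.swap_apply_right]
      exact hc.2.2
  · intro c hc
    simp only [Finset.mem_filter, mem_properColorings, Finset.mem_inter, Finset.mem_univ,
      and_true] at hc ⊢
    refine ⟨h.isProper_kempeSwap hc.1 a b, ?_, ?_⟩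
    · rw [h.available_parent]
      exact hc.2.1
    · rw [h.mem_available_root hc.1, Equiv.swap_apply_left]
      exact hc.2.2
  · intro c _
    exact kempeSwap_kempeSwap r a b
  · intro c _
    exact kempeSwap_kempeSwap r a b
  · intro c _
    rfl

/-- The number of pairs of a color missing at `p` and a color missing at `r`, in any proper coloring
of the forest. -/
noncomputable def pairCount (κ : ℕ) (par : V → Option V) (p r : V) : ℕ :=
  (κ - deg (toGraph par) p) * (κ - deg (toGraph par) r)

/-- Insertion, averaged over all proper colorings of the forest. The function `f` may depend on the
coloring before the insertion. -/
lemma Attachable.sum_attach (h : Attachable par p r) (hp : deg (toGraph par) p < κ)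
    (hr : deg (toGraph par) r < κ) (f : Coloring V κ → State V κ → ℝ≥0∞) :
    ∑ c ∈ properColorings κ (toGraph par), expect (attach ⟨par, c⟩ p r) (f c) =
      (pairCount κ par p r : ℝ≥0∞)⁻¹ * ∑ c ∈ properColorings κ (toGraph par),
        ∑ b ∈ available c p, ∑ a ∈ available c r, f c ⟨Function.update par r (some p),
          Function.update (kempeSwap par r a b c) s(p, r) (some b)⟩ := by
  rw [Finset.mul_sum]
  refine Finset.sum_congr rfl fun c hc => ?_
  rw [mem_properColorings] at hc
  rw [h.expect_attach hc (available_nonempty hc hp) (available_nonempty hc hr), ← Finset.mul_sum,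
    ← mul_assoc, card_available hc, card_available hc, pairCount, Nat.cast_mul, ENNReal.mul_inv]
  · right
    exact ENNReal.natCast_ne_top _
  · left
    exact ENNReal.natCast_ne_top _

/-- Insertion maps the uniform distribution to a multiple of the uniform distribution. -/
lemma Attachable.sum_attach_const (h : Attachable par p r) (hp : deg (toGraph par) p < κ)
    (hr : deg (toGraph par) r < κ) (f : State V κ → ℝ≥0∞) :
    ∑ c ∈ properColorings κ (toGraph par), expect (attach ⟨par, c⟩ p r) f =
      (pairCount κ par p r : ℝ≥0∞)⁻¹ * (κ *
        ∑ c ∈ properColorings κ (toGraph (Function.update par r (some p))),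
          f ⟨Function.update par r (some p), c⟩) := by
  rw [h.sum_attach hp hr, h.sum_kempeSwap fun c _ b => f ⟨Function.update par r (some p),
    Function.update c s(p, r) (some b)⟩, ← h.sum_extend, Finset.mul_sum]
  simp only [Finset.sum_const, Finset.card_univ, Fintype.card_fin, nsmul_eq_mul, Finset.mul_sum]

lemma Attachable.card_properColorings (h : Attachable par p r) (hp : deg (toGraph par) p < κ)
    (hr : deg (toGraph par) r < κ) :
    ((properColorings κ (toGraph par)).card : ℝ≥0∞) = (pairCount κ par p r : ℝ≥0∞)⁻¹ * (κ *
      (properColorings κ (toGraph (Function.update par r (some p)))).card) := by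
  have := h.sum_attach_const hp hr fun _ => 1
  simpa [expect_one] using this

/-- Deletion, averaged over all proper colorings of the forest. The function `f` may depend on the
coloring before the deletion. -/
lemma Attachable.sum_detach (h : Attachable par p r) (f : Coloring V κ → State V κ → ℝ≥0∞) :
    ∑ c ∈ properColorings κ (toGraph (Function.update par r (some p))),
        expect (detach ⟨Function.update par r (some p), c⟩ p r) (f c) =
      (κ : ℝ≥0∞)⁻¹ * ∑ c ∈ properColorings κ (toGraph par),
        ∑ b ∈ available c p ∩ available c r, ∑ a,
          f (Function.update c s(p, r) (some b)) ⟨par, kempeSwap par r a b c⟩ := by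
  rw [← h.sum_extend, Finset.mul_sum]
  refine Finset.sum_congr rfl fun c hc => ?_
  rw [Finset.mul_sum]
  refine Finset.sum_congr rfl fun b hb => ?_
  rw [mem_properColorings] at hc
  simp only [Finset.mem_inter, mem_available] at hb
  have hcol : Function.update (Function.update c s(p, r) (some b)) s(p, r) none = c := by
    rw [Function.update_idem, ← h.color_eq_none hc, Function.update_eq_self]
  rw [h.expect_detach (a := b) (by rwa [hcol]) (by simp) (by rw [hcol]; exact hb.2)]
  simp only [hcol, kempeSwap_comm r b]

/-- Deletion maps the uniform distribution to a multiple of the uniform distribution. -/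
lemma Attachable.sum_detach_const (h : Attachable par p r) (f : State V κ → ℝ≥0∞) :
    ∑ c ∈ properColorings κ (toGraph (Function.update par r (some p))),
        expect (detach ⟨Function.update par r (some p), c⟩ p r) f =
      (κ : ℝ≥0∞)⁻¹ * (pairCount κ par p r * ∑ c ∈ properColorings κ (toGraph par), f ⟨par, c⟩) := by
  rw [h.sum_detach, ← h.sum_kempeSwap fun c a b => f ⟨par, kempeSwap par r a b c⟩]
  refine congrArg ((κ : ℝ≥0∞)⁻¹ * ·) ?_
  simp only [kempeSwap_kempeSwap]
  rw [Finset.mul_sum]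
  refine Finset.sum_congr rfl fun c hc => ?_
  rw [mem_properColorings] at hc
  simp only [Finset.sum_const, nsmul_eq_mul, card_available hc, pairCount, Nat.cast_mul, mul_assoc]

end Uniform

/-! ### The law of the alternating path -/

section Chain

variable {V : Type} {κ : ℕ} {par : V → Option V} {c : Coloring V κ} {p r : V}

lemma transGen_up_of_step {a b : Fin κ} {x y : V} (h : TransGen (Step par c a b) x y) :
    TransGen (up par) x y :=
  TransGen.mono (r := Step par c a b) (p := up par) (fun _ _ h => h.1) _ _ h

/-- Edges on the path from `y` to its root are not affected by Kempe swaps at `y`. -/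
lemma kempeSwap_above (hp : Grounded par) {y u w : V} (hu : ReflTransGen (up par) y u)
    (huw : par u = some w) (d d' : Fin κ) : kempeSwap par y d d' c s(u, w) = c s(u, w) := by
  refine kempeSwap_of_not_below fun x' y' he hxy hy => ?_
  rcases Sym2.eq_iff.1 he with ⟨rfl, rfl⟩ | ⟨rfl, rfl⟩
  · exact hp.not_transGen _ (TransGen.head' hxy (hy.trans hu))
  · exact hp.asymm huw hxy

lemma transGen_step_kempeSwap (hp : Grounded par) {a b d d' : Fin κ} {y r : V}
    (h : TransGen (Step par c a b) y r) :
    TransGen (Step par (kempeSwap par y d d' c) a b) y r := by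
  induction h with
  | single h =>
    refine TransGen.single ⟨h.1, ?_⟩
    rw [kempeSwap_above hp ReflTransGen.refl h.1]
    exact h.2
  | tail h1 h2 ih =>
    refine TransGen.tail ih ⟨h2.1, ?_⟩
    rw [kempeSwap_above hp (transGen_up_of_step h1).to_reflTransGen h2.1]
    exact h2.2

/-- The color of the edge above `r` appears on no child edge of `r`. -/
lemma ne_of_transGen_step (hp : Grounded par) (hr : par r = some p) (hc : IsProper (toGraph par) c)
    {a b : Fin κ} {y : V} (hb : c s(p, r) = some b) (h : TransGen (Step par c a b) y r) :
    a ≠ b := by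
  rintro rfl
  obtain ⟨w, -, hwr, hw⟩ := TransGen.tail'_iff.1 h
  have h1 : c s(r, w) = some a := by rw [Sym2.eq_swap]; tauto
  have h2 : c s(r, p) = some a := by rw [Sym2.eq_swap]; exact hb
  obtain rfl := hc.inj r w p (hc.adj h1) (hc.adj h2) (h1.trans h2.symm)
  exact hp.asymm hr hwr

variable [Fintype V]

open scoped Classical in
/-- The vertices below `r` that are joined to `r` by a path in the colors `a` and `b`, where `b` is
the color of the edge between `r` and its parent `p`. -/
noncomputable def chain (par : V → Option V) (p r : V) (c : Coloring V κ) (a : Fin κ) : Finset V :=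
  Finset.univ.filter fun x => ∃ b, c s(p, r) = some b ∧ TransGen (Step par c a b) x r

lemma mem_chain {a : Fin κ} {x : V} :
    x ∈ chain par p r c a ↔ ∃ b, c s(p, r) = some b ∧ TransGen (Step par c a b) x r := by
  simp [chain]

/-- If `x` is a child of `r`, then it is on the alternating path exactly if `a` is the color of the
edge between `r` and `x`. -/
lemma sum_card_chain_child [DecidableEq V] (hp : Grounded par) (hr : par r = some p) {x : V}
    (hx : par x = some r) :
    ∑ a, {c ∈ properColorings κ (toGraph par) | x ∈ chain par p r c a}.card =
      (properColorings κ (toGraph par)).card := by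
  classical
  simp only [Finset.card_filter]
  rw [Finset.sum_comm, Finset.card_eq_sum_ones]
  refine Finset.sum_congr rfl fun c hc => ?_
  rw [mem_properColorings] at hc
  obtain ⟨b, hb⟩ := hc.exists_color (hp.adj_iff.2 (Or.inr hr))
  obtain ⟨d, hd⟩ := hc.exists_color (hp.adj_iff.2 (Or.inl hx))
  have hchain : ∀ a, x ∈ chain par p r c a ↔ a = d := by
    intro a
    rw [mem_chain]
    constructor
    · rintro ⟨b', hb', h⟩
      have hab := ne_of_transGen_step hp hr hc hb' h
      obtain rfl : b = b' := Option.some.inj (hb.symm.trans hb')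
      obtain ⟨y, hxy, -⟩ := TransGen.head'_iff.1 h
      obtain rfl : r = y := Option.some.inj (hx.symm.trans hxy.1)
      rcases hxy.2 with h1 | h1
      · exact Option.some.inj (h1.symm.trans hd)
      · have h2 : TransGen (Step par c b b) x r := TransGen.single ⟨hx, Or.inl h1⟩
        exact absurd rfl (ne_of_transGen_step hp hr hc hb h2)
    · rintro rfl
      exact ⟨b, hb, TransGen.single ⟨hx, Or.inl hd⟩⟩
  simp [hchain]

/-- If `x` is a child of `y`, then the alternating path continues from `y` to `x` with probability
`1 / (κ - 1)`: given the colors outside the subtree of `y`, all colors other than that of the edge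
above `y` are equally likely for the edge between `y` and `x`. -/
lemma card_chain_step [DecidableEq V] (hp : Grounded par) (hr : par r = some p) {x y : V}
    (hx : par x = some y) (hy : TransGen (up par) y r) (a : Fin κ) :
    (κ - 1) * {c ∈ properColorings κ (toGraph par) | x ∈ chain par p r c a}.card =
      {c ∈ properColorings κ (toGraph par) | y ∈ chain par p r c a}.card := by
  classical
  obtain ⟨z, hz, -⟩ := TransGen.head'_iff.1 hy
  have hyr : y ≠ r := by rintro rfl; exact hp.not_transGen _ hy
  -- the path passes through `x` if it passes through `y` and the edge below has one of its colors
  have hxy : ∀ c : Coloring V κ, x ∈ chain par p r c a ↔ y ∈ chain par p r c a ∧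
      (c s(y, x) = some a ∨ c s(p, r) = c s(y, x)) := by
    intro c
    simp only [mem_chain]
    constructor
    · rintro ⟨b, hb, h⟩
      obtain ⟨y', hxy, hyr'⟩ := TransGen.head'_iff.1 h
      obtain rfl : y = y' := Option.some.inj (hx.symm.trans hxy.1)
      refine ⟨⟨b, hb, (reflTransGen_iff_eq_or_transGen.1 hyr').resolve_left hyr.symm⟩, ?_⟩
      rw [hb, Sym2.eq_swap]
      exact hxy.2.imp id Eq.symm
    · rintro ⟨⟨b, hb, h⟩, h'⟩
      rw [hb, Sym2.eq_swap] at h'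
      exact ⟨b, hb, TransGen.head ⟨hx, h'.imp id Eq.symm⟩ h⟩
  rw [Finset.card_eq_sum_card_fiberwise (f := fun c : Coloring V κ => (c s(p, r), c s(y, z)))
      (t := Finset.univ) (fun _ _ => by simp),
    Finset.card_eq_sum_card_fiberwise (f := fun c : Coloring V κ => (c s(p, r), c s(y, z)))
      (s := {c ∈ properColorings κ (toGraph par) | y ∈ chain par p r c a})
      (t := Finset.univ) (fun _ _ => by simp), Finset.mul_sum]
  refine Finset.sum_congr rfl fun k _ => ?_
  simp only [Finset.filter_filter]
  rcases Finset.eq_empty_or_nonempty {c ∈ properColorings κ (toGraph par) |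
    y ∈ chain par p r c a ∧ (c s(p, r), c s(y, z)) = k} with hemp | ⟨c₀, hc₀⟩
  · have hemp' : {c ∈ properColorings κ (toGraph par) |
        x ∈ chain par p r c a ∧ (c s(p, r), c s(y, z)) = k} = ∅ := by
      refine Finset.eq_empty_of_forall_notMem fun c hc => ?_
      rw [Finset.mem_filter, hxy] at hc
      have : c ∈ (∅ : Finset (Coloring V κ)) := by
        rw [← hemp, Finset.mem_filter]
        exact ⟨hc.1, hc.2.1.1, hc.2.2⟩
      simp at this
    rw [hemp, hemp']
    simp
  rw [Finset.mem_filter, mem_properColorings, mem_chain] at hc₀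
  obtain ⟨hc₀, ⟨b, hb, h₀⟩, rfl⟩ := hc₀
  have hab := ne_of_transGen_step hp hr hc₀ hb h₀
  obtain ⟨e, he, heab⟩ : ∃ e, c₀ s(y, z) = some e ∧ (e = a ∨ e = b) := by
    obtain ⟨z', hz', -⟩ := TransGen.head'_iff.1 h₀
    obtain rfl : z = z' := Option.some.inj (hz.symm.trans hz'.1)
    rcases hz'.2 with h1 | h1
    · exact ⟨a, h1, Or.inl rfl⟩
    · exact ⟨b, h1, Or.inr rfl⟩
  rw [hb, he]
  simp only [Prod.mk.injEq]
  -- the colorings that extend the path to `y` and give the color `d` to the edge below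
  let G : Fin κ → Finset (Coloring V κ) := fun d => {c ∈ properColorings κ (toGraph par) |
    (y ∈ chain par p r c a ∧ c s(p, r) = some b ∧ c s(y, z) = some e) ∧ c s(y, x) = some d}
  have hmaps : ∀ d d', d ≠ e → d' ≠ e → ∀ c ∈ G d, kempeSwap par y d d' c ∈ G d' := by
    intro d d' hd hd' c hc
    simp only [G, Finset.mem_filter, mem_properColorings, mem_chain] at hc ⊢
    obtain ⟨hc, ⟨⟨b', hb', hchain⟩, hcb, hce⟩, hcd⟩ := hc
    have hv : ∀ w, par y = some w → c s(y, w) ≠ some d ∧ c s(y, w) ≠ some d' := by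
      intro w hw
      obtain rfl : z = w := Option.some.inj (hz.symm.trans hw)
      rw [hce]
      simp [hd.symm, hd'.symm]
    have hpr : kempeSwap par y d d' c s(p, r) = c s(p, r) := by
      rw [Sym2.eq_swap]
      exact kempeSwap_above hp hy.to_reflTransGen hr d d'
    refine ⟨hc.kempeSwap hp le_rfl hv, ⟨⟨b', hpr.trans hb', transGen_step_kempeSwap hp hchain⟩,
      hpr.trans hcb, (kempeSwap_above hp ReflTransGen.refl hz d d').trans hce⟩, ?_⟩
    rw [kempeSwap_apply_self hp le_rfl hc hv, hcd]
    simp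
  have hcardG : ∀ d d', d ≠ e → d' ≠ e → (G d).card = (G d').card := by
    intro d d' hd hd'
    refine Finset.card_nbij' (kempeSwap par y d d') (kempeSwap par y d d')
      (hmaps d d' hd hd') ?_ (fun c _ => kempeSwap_kempeSwap _ _ _)
      (fun c _ => kempeSwap_kempeSwap _ _ _)
    intro c hc
    rw [kempeSwap_comm]
    exact hmaps d' d hd' hd c hc
  have hadj : (toGraph par).Adj y x := hp.adj_iff.2 (Or.inr hx)
  have hcolx : ∀ c : Coloring V κ, IsProper (toGraph par) c → c s(y, z) = some e →
      ∃ d, d ≠ e ∧ c s(y, x) = some d := by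
    intro c hc hce
    obtain ⟨d, hd⟩ := hc.exists_color hadj
    refine ⟨d, ?_, hd⟩
    rintro rfl
    obtain rfl := hc.inj y x z hadj (hc.adj hce) (hd.trans hce.symm)
    exact hp.asymm hx hz
  obtain ⟨o, hoe, ho⟩ : ∃ o, o ≠ e ∧ ∀ d, d ≠ e → (d = a ∨ b = d ↔ d = o) := by
    rcases heab with rfl | rfl
    · exact ⟨b, hab.symm, by grind⟩
    · exact ⟨a, hab, by grind⟩
  have hX : {c ∈ properColorings κ (toGraph par) |
      x ∈ chain par p r c a ∧ c s(p, r) = some b ∧ c s(y, z) = some e} = G o := by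
    ext c
    simp only [G, Finset.mem_filter, mem_properColorings, hxy]
    refine and_congr_right fun hc => ?_
    constructor
    · rintro ⟨⟨h1, h2⟩, h3, h4⟩
      refine ⟨⟨h1, h3, h4⟩, ?_⟩
      obtain ⟨d, hd, hcd⟩ := hcolx c hc h4
      rw [hcd, h3, Option.some.injEq, Option.some.injEq, ho d hd] at h2
      rw [hcd, h2]
    · rintro ⟨⟨h1, h3, h4⟩, h2⟩
      refine ⟨⟨h1, ?_⟩, h3, h4⟩
      rw [h2, h3, Option.some.injEq, Option.some.injEq, ho o hoe]
  have hY : {c ∈ properColorings κ (toGraph par) |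
      y ∈ chain par p r c a ∧ c s(p, r) = some b ∧ c s(y, z) = some e}.card =
        ∑ d ∈ Finset.univ.erase e, (G d).card := by
    rw [Finset.card_eq_sum_card_fiberwise (f := fun c : Coloring V κ => (c s(y, x)).getD e)
      (t := Finset.univ.erase e)]
    · refine Finset.sum_congr rfl fun d hd => congrArg _ ?_
      ext c
      simp only [G, Finset.mem_filter, mem_properColorings, and_assoc]
      refine and_congr_right fun hc => and_congr_right fun _ => and_congr_right fun _ =>
        and_congr_right fun hce => ?_
      obtain ⟨d', -, hcd⟩ := hcolx c hc hce
      simp [hcd]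
    · intro c hc
      simp only [Finset.coe_filter, Set.mem_ofPred_eq, mem_properColorings] at hc
      obtain ⟨d, hd, hcd⟩ := hcolx c hc.1 hc.2.2.2
      simp [hcd, hd]
  rw [hX, hY, Finset.sum_congr rfl fun d hd => hcardG d o (Finset.ne_of_mem_erase hd) hoe,
    Finset.sum_const, Finset.card_erase_of_mem (Finset.mem_univ e), Finset.card_univ,
    Fintype.card_fin, smul_eq_mul]

/-- For a uniformly random proper coloring and a uniformly random color `a`, a vertex `i + 1` levels
below `r` is on the alternating path with probability `1 / (κ * (κ - 1) ^ i)`. -/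
lemma sum_card_chain_level [DecidableEq V] (hp : Grounded par) (hr : par r = some p) {i : ℕ} {x : V}
    (hx : x ∈ level par (i + 1) r) :
    (κ - 1) ^ i * ∑ a, {c ∈ properColorings κ (toGraph par) | x ∈ chain par p r c a}.card =
      (properColorings κ (toGraph par)).card := by
  induction i generalizing x with
  | zero =>
    obtain ⟨y, hy, hxy⟩ := mem_level_succ.1 hx
    obtain rfl : y = r := by simpa [level] using hy
    rw [pow_zero, one_mul, sum_card_chain_child hp hr hxy]
  | succ i ih =>
    obtain ⟨y, hy, hxy⟩ := mem_level_succ.1 hx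
    rw [← ih hy, pow_succ, mul_assoc, Finset.mul_sum]
    simp only [card_chain_step hp hr hxy (transGen_of_mem_level hy)]

/-- The sum `∑ i, N i / (κ - 1) ^ i`, where `N i` is the number of vertices `i + 1` levels below `r`.
It is `κ` times the expected length of the alternating path below `r`. -/
noncomputable def levelSum (κ : ℕ) [DecidableEq V] (par : V → Option V) (r : V) : ℝ≥0∞ :=
  ∑ i ∈ Finset.range (Fintype.card V), ((level par (i + 1) r).card : ℝ≥0∞) / ((κ : ℝ≥0∞) - 1) ^ i

lemma sum_card_chain [DecidableEq V] (hκ : 2 ≤ κ) (hp : Grounded par) (hr : par r = some p) :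
    ∑ c ∈ properColorings κ (toGraph par), ∑ a, ((chain par p r c a).card : ℝ≥0∞) =
      (properColorings κ (toGraph par)).card * levelSum κ par r := by
  classical
  have h1 : ∀ c a, chain par p r c a = (Finset.range (Fintype.card V)).biUnion
      fun i => {x ∈ level par (i + 1) r | x ∈ chain par p r (c : Coloring V κ) a} := by
    intro c a
    ext x
    simp only [Finset.mem_biUnion, Finset.mem_filter, Finset.mem_range]
    refine ⟨fun hx => ?_, fun ⟨_, _, _, hx⟩ => hx⟩
    obtain ⟨b, -, h⟩ := mem_chain.1 hx
    obtain ⟨i, hi⟩ := exists_mem_level (transGen_up_of_step h)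
    refine ⟨i, ?_, hi, hx⟩
    by_contra hcard
    simp [hp.level_eq_empty r (show Fintype.card V ≤ i + 1 by omega)] at hi
  have h2 : ∀ c : Coloring V κ, ∀ a, ((chain par p r c a).card : ℝ≥0∞) =
      ∑ i ∈ Finset.range (Fintype.card V), ∑ x ∈ level par (i + 1) r,
        if x ∈ chain par p r c a then 1 else 0 := by
    intro c a
    conv_lhs => rw [h1 c a]
    rw [Finset.card_biUnion]
    · simp [Finset.card_filter]
    · intro i _ j _ hij
      exact Finset.disjoint_filter_filter (hp.level_disjoint (by omega) r)
  simp only [h2]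
  rw [levelSum, Finset.mul_sum, Finset.sum_congr rfl fun c _ => Finset.sum_comm, Finset.sum_comm]
  refine Finset.sum_congr rfl fun i _ => ?_
  rw [Finset.sum_congr rfl fun c _ => Finset.sum_comm, Finset.sum_comm]
  have h3 : ∀ x ∈ level par (i + 1) r, ∑ c ∈ properColorings κ (toGraph par), ∑ a : Fin κ,
      (if x ∈ chain par p r c a then (1 : ℝ≥0∞) else 0) =
        (properColorings κ (toGraph par)).card / ((κ : ℝ≥0∞) - 1) ^ i := by
    intro x hx
    have h4 := sum_card_chain_level (κ := κ) hp hr hx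
    have h5 : (κ : ℝ≥0∞) - 1 = ((κ - 1 : ℕ) : ℝ≥0∞) := by simp
    rw [h5, ENNReal.eq_div_iff, ← h4, Finset.sum_comm]
    · push_cast
      simp
    · have : 0 < κ - 1 := by omega
      positivity
    · exact ENNReal.pow_ne_top (ENNReal.natCast_ne_top _)
  rw [Finset.sum_congr rfl h3, Finset.sum_const, nsmul_eq_mul, ENNReal.div_eq_inv_mul,
    ENNReal.div_eq_inv_mul]
  ring

variable [DecidableEq V]

/-- Every vertex of an alternating path that starts at `r` corresponds to the edge to its parent. -/
lemma Attachable.ncard_kempeEdge (h : Attachable par p r) (hc : IsProper (toGraph par) c)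
    (a b : Fin κ) : {e | KempeEdge par c r a b e}.ncard =
      (chain (Function.update par r (some p)) p r
        (Function.update c s(p, r) (some b)) a).card := by
  classical
  have hstep : ∀ x y, par x = some y → s(x, y) ≠ s(p, r) := by
    intro x y hxy he
    rcases Sym2.eq_iff.1 he with ⟨rfl, rfl⟩ | ⟨rfl, rfl⟩
    · exact h.not_below (ReflTransGen.single hxy)
    · simp [h.root] at hxy
  have hmem : ∀ x, x ∈ chain (Function.update par r (some p)) p r
      (Function.update c s(p, r) (some b)) a ↔ TransGen (Step par c a b) x r := by
    intro x
    rw [mem_chain]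
    constructor
    · rintro ⟨b', hb', hx⟩
      obtain rfl : b = b' := by simpa using hb'
      have hx' := transGen_up_of_step hx
      obtain ⟨y, hxy, hyr⟩ := TransGen.head'_iff.1 hx
      rw [← h.step_update hc]
      refine TransGen.head' ?_ (reflTransGen_step_congr ?_ hyr)
      · obtain ⟨h1, h2⟩ := hxy
        refine ⟨h1, ?_⟩
        rwa [Function.update_of_ne] at h2
        have hxr : x ≠ r := by rintro rfl; exact h.grounded_update.not_transGen _ hx'
        exact hstep x y (by rwa [Function.update_of_ne hxr] at h1)
      · intro u w hu huw
        refine ⟨huw, ?_⟩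
        rw [Function.update_of_ne]
        have hur : u ≠ r := by rintro rfl; exact h.grounded_update.not_transGen _ hu
        exact hstep u w (by rwa [Function.update_of_ne hur] at huw)
    · intro hx
      refine ⟨b, by simp, ?_⟩
      refine TransGen.mono (r := Step par c a b) (fun u w huw => ?_) _ _ hx
      refine ⟨?_, ?_⟩
      · have hur : u ≠ r := by rintro rfl; simpa [h.root] using huw.1
        rw [Function.update_of_ne hur]
        exact huw.1
      · rw [Function.update_of_ne (hstep u w huw.1)]
        exact huw.2
  rw [← Set.ncard_coe_finset]
  symm
  have hsome : ∀ x, TransGen (Step par c a b) x r → par x = some ((par x).getD x) := by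
    intro x hx
    obtain ⟨y, hxy, -⟩ := TransGen.head'_iff.1 hx
    simp [hxy.1]
  refine Set.ncard_congr (fun x _ => s(x, (par x).getD x)) ?_ ?_ ?_
  · intro x hx
    rw [Finset.mem_coe, hmem] at hx
    obtain ⟨y, hxy, hyr⟩ := TransGen.head'_iff.1 hx
    exact ⟨x, y, by simp [hxy.1], hxy, hyr⟩
  · intro x y hx hy he
    rw [Finset.mem_coe, hmem] at hx hy
    rcases Sym2.eq_iff.1 he with ⟨h1, -⟩ | ⟨h1, h2⟩
    · exact h1
    · have hx' := hsome x hx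
      have hy' := hsome y hy
      rw [h2] at hx'
      rw [← h1] at hy'
      exact absurd hy' (h.grounded.asymm hx')
  · rintro e ⟨x, y, rfl, hxy, hyr⟩
    exact ⟨x, by rw [Finset.mem_coe, hmem]; exact TransGen.head' hxy hyr, by simp [hxy.1]⟩

/-- The recolored edges that count for the recourse are those of the alternating path, as neither
insertion nor deletion counts the edge between `p` and `r` itself. -/
lemma Attachable.recourse_eq (h : Attachable par p r) (hc : IsProper (toGraph par) c) {a b : Fin κ}
    (hab : a ∈ available c r ∨ b ∈ available c r) {s s' : State V κ}
    (hs : ∀ e, e ≠ s(p, r) → s.col e = c e)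
    (hs' : ∀ e, e ≠ s(p, r) → s'.col e = kempeSwap par r a b c e)
    (hpr : s.col s(p, r) = none ∨ s'.col s(p, r) = none) :
    recourse s s' = {e | KempeEdge par c r a b e}.ncard := by
  rw [recourse, ← Set.ncard_coe_finset]
  congr 1
  ext e
  simp only [Finset.coe_filter, Finset.mem_univ, true_and, Set.mem_ofPred_eq]
  by_cases he : e = s(p, r)
  · subst he
    have h1 : ¬ KempeEdge par c r a b s(p, r) := fun hk => by
      simpa [h.color_eq_none hc] using hk.color
    simp only [h1, iff_false]
    tauto
  · rw [hs e he, hs' e he, Ne, Ne, kempeSwap_eq_none_iff]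
    constructor
    · rintro ⟨-, -, h3⟩
      by_contra hk
      exact h3 (by rw [kempeSwap, if_neg hk])
    · intro hk
      have hne : a ≠ b := by
        rintro rfl
        obtain ⟨w, -, hw, -⟩ := hk.exists_child
        have h1 : a ∈ available c r := by tauto
        exact mem_available.1 h1 w (by tauto)
      rw [kempeSwap, if_pos hk]
      rcases hk.color with h1 | h1 <;> simp [h1, hne, hne.symm]

lemma Attachable.sum_ncard_kempeEdge (h : Attachable par p r) (hκ : 2 ≤ κ) :
    ∑ c ∈ properColorings κ (toGraph par), ∑ b ∈ available c p ∩ available c r, ∑ a,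
        ({e | KempeEdge par c r a b e}.ncard : ℝ≥0∞) =
      (properColorings κ (toGraph (Function.update par r (some p)))).card *
        levelSum κ (Function.update par r (some p)) r := by
  rw [← sum_card_chain (p := p) hκ h.grounded_update (by simp), ← h.sum_extend]
  refine Finset.sum_congr rfl fun c hc => Finset.sum_congr rfl fun b _ =>
    Finset.sum_congr rfl fun a _ => ?_
  rw [h.ncard_kempeEdge (mem_properColorings.1 hc)]

/-- Insertion preserves the uniform distribution. -/
lemma Attachable.isUniform_attach (h : Attachable par p r) (hp : deg (toGraph par) p < κ)
    (hr : deg (toGraph par) r < κ) {par₀ : V → Option V} (hG : toGraph par₀ = toGraph par)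
    {μ : PMF (State V κ)} (hμ : IsUniform μ par₀) {step : State V κ → PMF (State V κ)}
    (hstep : ∀ c, step ⟨par₀, c⟩ = attach ⟨par, c⟩ p r) :
    IsUniform (μ.bind step) (Function.update par r (some p)) := by
  refine isUniform_of_const (K := ((properColorings κ (toGraph par)).card : ℝ≥0∞)⁻¹ *
    ((pairCount κ par p r : ℝ≥0∞)⁻¹ * κ)) fun f => ?_
  rw [expect_bind, hμ]
  simp only [hstep, hG]
  rw [h.sum_attach_const hp hr]
  ring

/-- The expected recourse of an insertion. -/
lemma Attachable.expect_recourse_attach (h : Attachable par p r) (hκ : 2 ≤ κ)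
    (hp : deg (toGraph par) p < κ)
    (hr : deg (toGraph par) r < κ) {par₀ : V → Option V} (hG : toGraph par₀ = toGraph par)
    {μ : PMF (State V κ)} (hμ : IsUniform μ par₀) {step : State V κ → PMF (State V κ)}
    (hstep : ∀ c, step ⟨par₀, c⟩ = attach ⟨par, c⟩ p r) :
    expect μ (fun s => expect (step s) fun s' => (recourse s s' : ℝ≥0∞)) =
      (κ : ℝ≥0∞)⁻¹ * levelSum κ (Function.update par r (some p)) r := by
  have hne := hμ.nonempty
  rw [hμ]
  simp only [hstep, hG] at hne ⊢
  rw [h.sum_attach hp hr fun c s' => (recourse (⟨par₀, c⟩ : State V κ) s' : ℝ≥0∞)]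
  have h1 : ∑ c ∈ properColorings κ (toGraph par), ∑ b ∈ available c p, ∑ a ∈ available c r,
      (recourse (⟨par₀, c⟩ : State V κ) ⟨Function.update par r (some p),
        Function.update (kempeSwap par r a b c) s(p, r) (some b)⟩ : ℝ≥0∞) =
      (properColorings κ (toGraph (Function.update par r (some p)))).card *
        levelSum κ (Function.update par r (some p)) r := by
    rw [← h.sum_ncard_kempeEdge hκ, ← h.sum_kempeSwap fun c a b =>
      ({e | KempeEdge par c r a b e}.ncard : ℝ≥0∞)]
    refine Finset.sum_congr rfl fun c hc => Finset.sum_congr rfl fun b _ =>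
      Finset.sum_congr rfl fun a ha => ?_
    rw [mem_properColorings] at hc
    rw [kempeEdge_kempeSwap, h.recourse_eq (b := b) hc (Or.inl ha) (fun _ _ => rfl)
      (fun e he => by simp [Function.update_of_ne he]) (Or.inl (h.color_eq_none hc))]
  have h2 := h.card_properColorings (κ := κ) hp hr
  have hpos : ((properColorings κ (toGraph par)).card : ℝ≥0∞) ≠ 0 := by
    simpa using hne.ne_empty
  rw [h1, h2]
  rw [h2] at hpos
  have hP : ((properColorings κ (toGraph (Function.update par r (some p)))).card : ℝ≥0∞) ≠ 0 := by
    intro h0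
    simp [h0] at hpos
  have hpc : (pairCount κ par p r : ℝ≥0∞) ≠ 0 := by
    rw [pairCount]
    have h3 : 0 < κ - deg (toGraph par) p := by omega
    have h4 : 0 < κ - deg (toGraph par) r := by omega
    exact_mod_cast (Nat.mul_pos h3 h4).ne'
  have hκ0 : (κ : ℝ≥0∞) ≠ 0 := by
    have : κ ≠ 0 := by omega
    exact_mod_cast this
  rw [ENNReal.mul_inv (Or.inr (ENNReal.mul_ne_top (ENNReal.natCast_ne_top _)
      (ENNReal.natCast_ne_top _))) (Or.inr (mul_ne_zero hκ0 hP)),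
    ENNReal.mul_inv (Or.inl hκ0) (Or.inl (ENNReal.natCast_ne_top _)), inv_inv]
  generalize levelSum κ (Function.update par r (some p)) r = S
  calc _ = ((pairCount κ par p r : ℝ≥0∞) * (pairCount κ par p r : ℝ≥0∞)⁻¹) *
        (((properColorings κ (toGraph (Function.update par r (some p)))).card : ℝ≥0∞) *
        ((properColorings κ (toGraph (Function.update par r (some p)))).card : ℝ≥0∞)⁻¹) *
        ((κ : ℝ≥0∞)⁻¹ * S) := by ring
    _ = _ := by
      rw [ENNReal.mul_inv_cancel hpc (ENNReal.natCast_ne_top _),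
        ENNReal.mul_inv_cancel hP (ENNReal.natCast_ne_top _), one_mul, one_mul]

/-- Deletion preserves the uniform distribution. -/
lemma Attachable.isUniform_detach (h : Attachable par p r) {μ : PMF (State V κ)}
    (hμ : IsUniform μ (Function.update par r (some p))) {step : State V κ → PMF (State V κ)}
    (hstep : ∀ c, step ⟨Function.update par r (some p), c⟩ =
      detach ⟨Function.update par r (some p), c⟩ p r) :
    IsUniform (μ.bind step) par := by
  refine isUniform_of_const (K := ((properColorings κ
    (toGraph (Function.update par r (some p)))).card : ℝ≥0∞)⁻¹ *
    ((κ : ℝ≥0∞)⁻¹ * pairCount κ par p r)) fun f => ?_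
  rw [expect_bind, hμ]
  simp only [hstep]
  rw [h.sum_detach_const]
  ring

/-- The expected recourse of a deletion. -/
lemma Attachable.expect_recourse_detach (h : Attachable par p r) (hκ : 2 ≤ κ)
    {μ : PMF (State V κ)} (hμ : IsUniform μ (Function.update par r (some p)))
    {step : State V κ → PMF (State V κ)}
    (hstep : ∀ c, step ⟨Function.update par r (some p), c⟩ =
      detach ⟨Function.update par r (some p), c⟩ p r) :
    expect μ (fun s => expect (step s) fun s' => (recourse s s' : ℝ≥0∞)) =
      (κ : ℝ≥0∞)⁻¹ * levelSum κ (Function.update par r (some p)) r := by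
  have hne := hμ.nonempty
  rw [hμ]
  simp only [hstep]
  rw [h.sum_detach fun c s' =>
    (recourse (⟨Function.update par r (some p), c⟩ : State V κ) s' : ℝ≥0∞)]
  have h1 : ∑ c ∈ properColorings κ (toGraph par), ∑ b ∈ available c p ∩ available c r, ∑ a,
      (recourse (⟨Function.update par r (some p), Function.update c s(p, r) (some b)⟩ : State V κ)
        ⟨par, kempeSwap par r a b c⟩ : ℝ≥0∞) =
      (properColorings κ (toGraph (Function.update par r (some p)))).card *
        levelSum κ (Function.update par r (some p)) r := by
    rw [← h.sum_ncard_kempeEdge hκ]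
    refine Finset.sum_congr rfl fun c hc => Finset.sum_congr rfl fun b hb =>
      Finset.sum_congr rfl fun a _ => ?_
    rw [mem_properColorings] at hc
    rw [h.recourse_eq hc (Or.inr (Finset.mem_inter.1 hb).2)
      (fun e he => by simp [Function.update_of_ne he]) (fun _ _ => rfl)
      (Or.inr ((kempeSwap_eq_none_iff _ _ _ _).2 (h.color_eq_none hc)))]
  have hP : ((properColorings κ (toGraph (Function.update par r (some p)))).card : ℝ≥0∞) ≠ 0 := by
    simpa using hne.ne_empty
  rw [h1, mul_left_comm, ← mul_assoc (_⁻¹) (_ : ℝ≥0∞) (levelSum _ _ _),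
    ENNReal.inv_mul_cancel hP (ENNReal.natCast_ne_top _), one_mul]

end Chain

/-! ### Numerical bounds -/

section Bounds

/-- The two upper bounds on the sum over the levels: the first compares with a geometric series, the
second bounds the first `⌈log n⌉` levels by `Δ - 1` each and the others by their total size. -/
lemma sum_level_le {Δ c n : ℕ} (hΔ : 3 ≤ Δ) (hn : 1 ≤ n) {N : ℕ → ℕ}
    (hN : ∀ i, N i ≤ (Δ - 1) ^ (i + 1)) (hsum : ∑ i ∈ Finset.range n, N i ≤ n) :
    ((Δ + c : ℕ) : ℝ)⁻¹ * ∑ i ∈ Finset.range n, (N i : ℝ) / ((Δ : ℝ) + c - 1) ^ i ≤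
      recourseBound Δ c n := by
  have hΔ' : (3 : ℝ) ≤ Δ := by exact_mod_cast hΔ
  have hc0 : (0 : ℝ) ≤ c := Nat.cast_nonneg c
  have hn' : (1 : ℝ) ≤ n := by exact_mod_cast hn
  set K : ℝ := (Δ : ℝ) + c - 1 with hK
  have hK1 : 1 < K := by linarith
  have hK0 : 0 < K := by linarith
  have hN' : ∀ i, (N i : ℝ) ≤ ((Δ : ℝ) - 1) ^ (i + 1) := by
    intro i
    have h1 : ((Δ - 1 : ℕ) : ℝ) = (Δ : ℝ) - 1 := by rw [Nat.cast_sub (by omega)]; simp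
    rw [← h1]
    exact_mod_cast hN i
  have hterm : ∀ i, (N i : ℝ) / K ^ i ≤ ((Δ : ℝ) - 1) * (((Δ : ℝ) - 1) / K) ^ i := by
    intro i
    rw [div_pow, ← mul_div_assoc, ← pow_succ']
    gcongr
    exact hN' i
  have hq1 : ((Δ : ℝ) - 1) / K ≤ 1 := by rw [div_le_one hK0]; linarith
  have hq0 : 0 ≤ ((Δ : ℝ) - 1) / K := div_nonneg (by linarith) hK0.le
  obtain ⟨L, hL⟩ : ∃ L : ℕ, (L : ℤ) = ⌈Real.logb K n⌉ :=
    ⟨_, Int.toNat_of_nonneg (Int.ceil_nonneg (Real.logb_nonneg hK1 hn'))⟩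
  have hLn : (n : ℝ) ≤ K ^ L := by
    have h1 : Real.logb K n ≤ L := by
      have h2 := Int.le_ceil (Real.logb K n)
      rw [← hL] at h2
      exact_mod_cast h2
    rw [← Real.rpow_natCast]
    exact (Real.logb_le_iff_le_rpow hK1 (by linarith)).1 h1
  have hlog : ∑ i ∈ Finset.range n, (N i : ℝ) / K ^ i ≤ Δ * (2 + L) := by
    have h1 : ∀ i ∈ Finset.range n,
        (N i : ℝ) / K ^ i ≤ (if i < L then (Δ : ℝ) - 1 else 0) + N i / n := by
      intro i _
      split_ifs with hi
      · have h2 : (N i : ℝ) / K ^ i ≤ (Δ : ℝ) - 1 := (hterm i).trans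
          (mul_le_of_le_one_right (by linarith) (pow_le_one₀ hq0 hq1))
        have h3 : (0 : ℝ) ≤ N i / n := by positivity
        linarith
      · rw [zero_add]
        refine div_le_div_of_nonneg_left (Nat.cast_nonneg _) (by linarith) (hLn.trans ?_)
        exact pow_le_pow_right₀ hK1.le (by omega)
    refine (Finset.sum_le_sum h1).trans ?_
    rw [Finset.sum_add_distrib, ← Finset.sum_div, ← Finset.sum_filter, Finset.sum_const,
      nsmul_eq_mul]
    have h2 : (((Finset.range n).filter (· < L)).card : ℝ) ≤ L := by
      have : ((Finset.range n).filter (· < L)).card ≤ (Finset.range L).card :=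
        Finset.card_le_card fun i hi => by simp at hi ⊢; exact hi.2
      simpa using (Nat.cast_le (α := ℝ)).2 this
    have h3 : (∑ i ∈ Finset.range n, (N i : ℝ)) / n ≤ 1 := by
      rw [div_le_one (by linarith)]
      exact_mod_cast hsum
    have h4 : (((Finset.range n).filter (· < L)).card : ℝ) * ((Δ : ℝ) - 1) ≤ L * ((Δ : ℝ) - 1) :=
      mul_le_mul_of_nonneg_right h2 (by linarith)
    have h5 : (0 : ℝ) ≤ L := Nat.cast_nonneg _
    nlinarith
  have hκ : ((Δ + c : ℕ) : ℝ) = Δ + c := by push_cast; ring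
  have hκ0 : (0 : ℝ) < Δ + c := by linarith
  have hceil : ((⌈Real.logb K n⌉ : ℤ) : ℝ) = L := by rw [← hL]; simp
  rw [recourseBound, hκ]
  split_ifs with hc
  · subst hc
    have hK' : (Δ : ℝ) - 1 = K := by simp [hK]
    rw [hK', hceil, inv_mul_le_iff₀ hκ0]
    simpa using hlog
  · rw [← hK, hceil, div_mul_eq_mul_div, ← div_eq_inv_mul]
    refine div_le_div_of_nonneg_right ?_ hκ0.le
    rw [mul_min_of_nonneg _ _ (by linarith), le_min_iff]
    refine ⟨?_, hlog⟩
    have hcpos : (0 : ℝ) < c := by exact_mod_cast Nat.pos_of_ne_zero hc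
    have h1 : (∑ i ∈ Finset.range n, (((Δ : ℝ) - 1) / K) ^ i) ≤ K / c := by
      have h2 := geom_sum_mul_neg (((Δ : ℝ) - 1) / K) n
      have h3 : 1 - ((Δ : ℝ) - 1) / K = c / K := by
        rw [eq_div_iff hK0.ne', sub_mul, div_mul_cancel₀ _ hK0.ne', hK]
        ring
      rw [h3] at h2
      have h4 : 0 ≤ (((Δ : ℝ) - 1) / K) ^ n := pow_nonneg hq0 n
      rw [le_div_iff₀ hcpos]
      calc _ = ((∑ i ∈ Finset.range n, (((Δ : ℝ) - 1) / K) ^ i) * (c / K)) * K := by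
              field_simp
        _ ≤ 1 * K := by
              refine mul_le_mul_of_nonneg_right ?_ hK0.le
              linarith
        _ = K := one_mul K
    have h5 : 0 ≤ K / c := by positivity
    calc _ ≤ ∑ i ∈ Finset.range n, ((Δ : ℝ) - 1) * (((Δ : ℝ) - 1) / K) ^ i :=
          Finset.sum_le_sum fun i _ => hterm i
      _ ≤ ((Δ : ℝ) - 1) * (K / c) := by
          rw [← Finset.mul_sum]
          exact mul_le_mul_of_nonneg_left h1 (by linarith)
      _ ≤ Δ * (K / c) := mul_le_mul_of_nonneg_right (by linarith) h5

lemma one_le_logb_of_le {K x : ℝ} (hK : 1 < K) (h : K ≤ x) : 1 ≤ Real.logb K x := by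
  rw [Real.le_logb_iff_rpow_le hK (by linarith), Real.rpow_one]
  exact h

lemma recourseBound_le {Δ c n : ℕ} (hΔ : 3 ≤ Δ) (hc : c + 2 ≤ Δ) (hn : 2 * Δ ≤ n) :
    recourseBound Δ c n ≤ 4 * recourseOrder Δ c n := by
  have hΔ' : (3 : ℝ) ≤ Δ := by exact_mod_cast hΔ
  have hc' : (c : ℝ) + 2 ≤ Δ := by exact_mod_cast hc
  have hn' : 2 * (Δ : ℝ) ≤ n := by exact_mod_cast hn
  have hc0 : (0 : ℝ) ≤ c := Nat.cast_nonneg c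
  rw [recourseBound, recourseOrder]
  split_ifs with h0
  · have h1 := one_le_logb_of_le (K := (Δ : ℝ) - 1) (x := n) (by linarith) (by linarith)
    have h2 := Int.ceil_lt_add_one (Real.logb ((Δ : ℝ) - 1) n)
    linarith
  · have hcpos : (0 : ℝ) < c := by exact_mod_cast Nat.pos_of_ne_zero h0
    have h1 := one_le_logb_of_le (K := (Δ : ℝ) + c - 1) (x := n) (by linarith) (by linarith)
    have h2 := Int.ceil_lt_add_one (Real.logb ((Δ : ℝ) + c - 1) n)
    rw [mul_min_of_nonneg _ _ (by norm_num : (0 : ℝ) ≤ 4)]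
    have h3 : (Δ : ℝ) / (Δ + c) ≤ 1 := by rw [div_le_one (by linarith)]; linarith
    have h4 : 0 ≤ min (((Δ : ℝ) + c - 1) / c) (2 + (⌈Real.logb ((Δ : ℝ) + c - 1) n⌉ : ℝ)) := by
      refine le_min (div_nonneg (by linarith) hc0) ?_
      have := Int.le_ceil (Real.logb ((Δ : ℝ) + c - 1) n)
      linarith
    refine (mul_le_of_le_one_left h4 h3).trans (min_le_min ?_ ?_)
    · rw [← mul_div_assoc]
      exact div_le_div_of_nonneg_right (by linarith) hc0
    · linarith

lemma le_geom_sum {x : ℝ} (hx0 : 0 ≤ x) (hx1 : x ≤ 1) (h : ℕ) :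
    (h : ℝ) ≤ (∑ i ∈ Finset.range h, (1 - x) ^ i) * (1 + h * x) := by
  induction h with
  | zero => simp
  | succ h ih =>
    rw [Finset.sum_range_succ']
    simp only [pow_succ, ← Finset.sum_mul, pow_zero]
    set S := ∑ i ∈ Finset.range h, (1 - x) ^ i
    have hS : 0 ≤ S := Finset.sum_nonneg fun i _ => pow_nonneg (by linarith) i
    have hh : (0 : ℝ) ≤ h := Nat.cast_nonneg h
    push_cast
    have h1 : 0 ≤ S * (1 - x) * x := mul_nonneg (mul_nonneg hS (by linarith)) hx0
    have h2 : (1 - x) * h ≤ (1 - x) * (S * (1 + h * x)) :=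
      mul_le_mul_of_nonneg_left ih (by linarith)
    nlinarith

/-- The lower bound on the sum over the `h` levels of a complete `(Δ - 1)`-ary tree. With
`x = c / (κ - 1)`, it rests on `log n ≤ h + 3 ≤ 4 * h`, on `∑ i < h, (1 - x) ^ i ≥ h / (1 + h * x)`, and
on `(Δ - 1) / κ ≥ 1 / 2`. -/
lemma le_sum_level {Δ c n h : ℕ} (hΔ : 3 ≤ Δ) (hc : c + 2 ≤ Δ) (hn1 : 1 ≤ n) (hh : 1 ≤ h)
    (hn : n ≤ (Δ - 1) ^ (h + 3)) {N : ℕ → ℕ} (hhn : h ≤ n)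
    (hN : ∀ i < h, (Δ - 1) ^ (i + 1) ≤ N i) :
    1 / 16 * recourseOrder Δ c n ≤
      ((Δ + c : ℕ) : ℝ)⁻¹ * ∑ i ∈ Finset.range n, (N i : ℝ) / ((Δ : ℝ) + c - 1) ^ i := by
  have hΔ' : (3 : ℝ) ≤ Δ := by exact_mod_cast hΔ
  have hc' : (c : ℝ) + 2 ≤ Δ := by exact_mod_cast hc
  have hc0 : (0 : ℝ) ≤ c := Nat.cast_nonneg c
  have hn' : (1 : ℝ) ≤ n := by exact_mod_cast hn1
  have hh' : (1 : ℝ) ≤ h := by exact_mod_cast hh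
  set K : ℝ := (Δ : ℝ) + c - 1 with hK
  have hK1 : 1 < K := by linarith
  have hK0 : 0 < K := by linarith
  set x : ℝ := c / K with hx
  have hx0 : 0 ≤ x := by positivity
  have hx1 : x ≤ 1 := by rw [hx, div_le_one hK0]; linarith
  have h1 : ((Δ - 1 : ℕ) : ℝ) = (Δ : ℝ) - 1 := by rw [Nat.cast_sub (by omega)]; simp
  have hqx : ((Δ : ℝ) - 1) / K = 1 - x := by
    rw [hx, eq_sub_iff_add_eq, ← add_div, div_eq_one_iff_eq hK0.ne']
    ring
  set S := ∑ i ∈ Finset.range h, (1 - x) ^ i with hS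
  have hsum : ((Δ : ℝ) - 1) * S ≤ ∑ i ∈ Finset.range n, (N i : ℝ) / K ^ i := by
    refine le_trans ?_ (Finset.sum_le_sum_of_subset_of_nonneg
      (Finset.range_subset_range.2 hhn) fun i _ _ => by positivity)
    rw [hS, Finset.mul_sum]
    refine Finset.sum_le_sum fun i hi => ?_
    rw [← hqx, div_pow, ← mul_div_assoc, ← pow_succ']
    refine div_le_div_of_nonneg_right ?_ (by positivity)
    rw [← h1]
    exact_mod_cast hN i (Finset.mem_range.1 hi)
  have hlog : ∀ K' : ℝ, (Δ : ℝ) - 1 ≤ K' → Real.logb K' n ≤ 4 * h := by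
    intro K' hK'
    have h2 : Real.logb K' n ≤ ((h + 3 : ℕ) : ℝ) := by
      rw [Real.logb_le_iff_le_rpow (by linarith) (by linarith), Real.rpow_natCast]
      calc (n : ℝ) ≤ ((Δ : ℝ) - 1) ^ (h + 3) := by
            rw [← h1]
            exact_mod_cast hn
        _ ≤ K' ^ (h + 3) := pow_le_pow_left₀ (by linarith) hK' _
    push_cast at h2
    linarith
  have hgeom := le_geom_sum hx0 hx1 h
  have hS0 : 0 ≤ S := Finset.sum_nonneg fun i _ => pow_nonneg (by linarith) i
  have hcast : ((Δ + c : ℕ) : ℝ) = Δ + c := by push_cast; ring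
  have hhalf : 1 / 2 * S ≤ ((Δ + c : ℕ) : ℝ)⁻¹ * ∑ i ∈ Finset.range n, (N i : ℝ) / K ^ i := by
    rw [hcast, ← div_eq_inv_mul, le_div_iff₀ (by linarith)]
    refine le_trans ?_ hsum
    nlinarith
  refine le_trans ?_ hhalf
  rw [recourseOrder]
  split_ifs with h0
  · have hx00 : x = 0 := by simp [hx, h0]
    rw [show (1 : ℝ) + h * x = 1 by rw [hx00]; ring, mul_one] at hgeom
    have := hlog ((Δ : ℝ) - 1) le_rfl
    linarith
  · have hcpos : (0 : ℝ) < c := by exact_mod_cast Nat.pos_of_ne_zero h0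
    have hlogK := hlog K (by linarith)
    -- `M` is at most `4 * h` and at most `1 / x`
    set M := min ((Δ : ℝ) / c) (Real.logb K n) with hM
    have hM1 : M ≤ 4 * h := (min_le_right _ _).trans hlogK
    have hM2 : M * x ≤ 1 := by
      calc M * x ≤ (Δ : ℝ) / c * x := mul_le_mul_of_nonneg_right (min_le_left _ _) hx0
        _ = Δ / K := by rw [hx]; field_simp
        _ ≤ 1 := by rw [div_le_one hK0]; linarith [show (1 : ℝ) ≤ c by exact_mod_cast hcpos]
    have h3 : M * (1 + h * x) ≤ 8 * (S * (1 + h * x)) := by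
      calc M * (1 + h * x) = M + h * (M * x) := by ring
        _ ≤ 4 * h + h * 1 := add_le_add hM1 (mul_le_mul_of_nonneg_left hM2 (by linarith))
        _ ≤ 8 * (S * (1 + h * x)) := by linarith
    have h4 : 0 < 1 + h * x := by positivity
    have h5 : M ≤ 8 * S := by
      refine le_of_mul_le_mul_right (?_ : M * (1 + h * x) ≤ 8 * S * (1 + h * x)) h4
      linarith
    linarith

end Bounds

/-! ### Admissible sequences -/

section Sequences

lemma forall_take_append {α : Type} (P : List α → α → Prop) (us : List α) (u : α) :
    (∀ t : Fin (us ++ [u]).length, P ((us ++ [u]).take t) ((us ++ [u]).get t)) ↔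
      (∀ t : Fin us.length, P (us.take t) (us.get t)) ∧ P us u := by
  constructor
  · intro h
    constructor
    · intro t
      have := h ⟨t, by simp⟩
      simpa [List.take_append_of_le_length t.2.le, List.getElem_append_left] using this
    · have := h ⟨us.length, by simp⟩
      simpa using this
  · rintro ⟨h1, h2⟩ ⟨t, ht⟩
    by_cases htl : t < us.length
    · have := h1 ⟨t, htl⟩
      simpa [List.take_append_of_le_length htl.le, List.getElem_append_left htl] using this
    · obtain rfl : t = us.length := by simp at ht; omega
      simpa using h2

variable {V : Type} {Δ : ℕ}

lemma legal_append_singleton {us : List (Update V)} {u : Update V} :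
    Legal Δ (us ++ [u]) ↔ Legal Δ us ∧ LegalUpdate Δ (forestAfter us) u :=
  forall_take_append (fun us u => LegalUpdate Δ (forestAfter us) u) us u

lemma forestAfter_append_singleton (us : List (Update V)) (u : Update V) :
    forestAfter (us ++ [u]) = applyUpdate (forestAfter us) u := by
  simp [forestAfter]

lemma deg_mono [Finite V] {G G' : SimpleGraph V} (h : G ≤ G') (v : V) : deg G v ≤ deg G' v :=
  Set.ncard_le_ncard (fun _ hw => h hw) (Set.toFinite _)

lemma deg_sup_edge_le [Finite V] {G : SimpleGraph V} (hG : ∀ v, deg G v ≤ Δ) {u v : V}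
    (hu : deg G u < Δ) (hv : deg G v < Δ) (w : V) : deg (G ⊔ SimpleGraph.edge u v) w ≤ Δ := by
  have h1 : ∀ w z, (∀ x, (SimpleGraph.edge u v).Adj w x → x = z) →
      deg (G ⊔ SimpleGraph.edge u v) w ≤ deg G w + 1 := by
    intro w z h
    refine (Set.ncard_le_ncard (t := insert z (G.neighborSet w)) ?_ (Set.toFinite _)).trans
      (Set.ncard_insert_le _ _)
    rintro x (hx | hx)
    · exact Or.inr hx
    · exact Or.inl (h x hx)
  by_cases hwu : w = u
  · subst hwu
    exact (h1 w v fun x hx => by rw [SimpleGraph.edge_adj] at hx; grind).trans hu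
  · by_cases hwv : w = v
    · subst hwv
      exact (h1 w u fun x hx => by rw [SimpleGraph.edge_adj] at hx; grind).trans hv
    · refine le_trans (Set.ncard_le_ncard ?_ (Set.toFinite _)) (hG w)
      rintro x (hx | hx)
      · exact hx
      · rw [SimpleGraph.edge_adj] at hx
        grind

lemma deg_applyUpdate_le [Finite V] {G : SimpleGraph V} (hG : ∀ v, deg G v ≤ Δ) {u : Update V}
    (hu : LegalUpdate Δ G u) (v : V) : deg (applyUpdate G u) v ≤ Δ := by
  cases u with
  | insert u w => exact deg_sup_edge_le hG hu.2.1 hu.2.2 v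
  | delete u w => exact (deg_mono (SimpleGraph.deleteEdges_le _) v).trans (hG v)

lemma deg_forestAfter_le [Finite V] {us : List (Update V)} (h : Legal Δ us) (v : V) :
    deg (forestAfter us) v ≤ Δ := by
  induction us using List.reverseRecOn generalizing v with
  | nil => simp [forestAfter, deg, SimpleGraph.neighborSet]
  | append_singleton us u ih =>
    obtain ⟨h1, h2⟩ := legal_append_singleton.1 h
    rw [forestAfter_append_singleton]
    exact deg_applyUpdate_le (ih h1) h2 v

lemma relink_succ (r₁ r₂ : V) (m : ℕ) :
    relink r₁ r₂ (m + 1) = relink r₁ r₂ m ++ [Update.insert r₁ r₂] ++ [Update.delete r₁ r₂] := by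
  simp [relink, List.replicate_succ', List.flatten_append]

variable [DecidableEq V]

lemma legalRooted_append_singleton {us : List (Update V)} {u : Update V} :
    LegalRooted Δ (us ++ [u]) ↔ LegalRooted Δ us ∧ LegalRootedUpdate Δ (rootedAfter us) u :=
  forall_take_append (fun us u => LegalRootedUpdate Δ (rootedAfter us) u) us u

lemma rootedAfter_append_singleton (us : List (Update V)) (u : Update V) :
    rootedAfter (us ++ [u]) = applyRooted (rootedAfter us) u := by
  simp [rootedAfter]

/-- An admissible sequence for rooted forests is also admissible for unrooted forests. -/
lemma legal_of_legalRooted {us : List (Update V)} (h : LegalRooted Δ us) :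
    Grounded (rootedAfter us) ∧ toGraph (rootedAfter us) = forestAfter us ∧ Legal Δ us := by
  induction us using List.reverseRecOn with
  | nil => exact ⟨grounded_none, toGraph_none, fun t => t.elim0⟩
  | append_singleton us u ih =>
    obtain ⟨h1, h2⟩ := legalRooted_append_singleton.1 h
    obtain ⟨hg, hG, hl⟩ := ih h1
    rw [legal_append_singleton, rootedAfter_append_singleton, forestAfter_append_singleton, ← hG]
    cases u with
    | insert p r =>
      have hA : Attachable (rootedAfter us) p r := ⟨hg, h2.1, h2.2.1⟩
      exact ⟨hA.grounded_update, toGraph_update_some hA.root hA.ne, hl, h2.2⟩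
    | delete p r =>
      exact ⟨hg.update_none r, toGraph_update_none hg h2, hl, hg.adj_iff.2 (Or.inr h2)⟩

/-- Linking two roots and cutting the edge again restores the forest. -/
lemma legalRooted_relink {us : List (Update V)} {r₁ r₂ : V} (h : LegalRooted Δ us)
    (hins : LegalRootedUpdate Δ (rootedAfter us) (Update.insert r₁ r₂)) (m : ℕ) :
    LegalRooted Δ (us ++ relink r₁ r₂ m) ∧
      rootedAfter (us ++ relink r₁ r₂ m) = rootedAfter us := by
  induction m with
  | zero => simpa [relink] using h
  | succ m ih =>
    rw [relink_succ, ← List.append_assoc, ← List.append_assoc]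
    simp only [legalRooted_append_singleton, rootedAfter_append_singleton, ih.2]
    refine ⟨⟨⟨ih.1, hins⟩, by simp [LegalRootedUpdate, applyRooted]⟩, ?_⟩
    simp only [applyRooted, Function.update_idem]
    rw [← hins.1, Function.update_eq_self]

end Sequences

/-! ### Building two complete trees -/

section Build

lemma deg_le_card_children {V : Type} [Fintype V] [DecidableEq V] {par : V → Option V}
    (hp : Grounded par) (v : V) : deg (toGraph par) v ≤ (children par v).card + 1 := by
  rw [deg, ← Set.ncard_coe_finset]
  rcases hv : par v with _ | p
  · refine (Set.ncard_le_ncard ?_ (Set.toFinite _)).trans (Nat.le_succ _)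
    intro w hw
    rcases hp.adj_iff.1 hw with h | h
    · simp [hv] at h
    · simpa [children] using h
  · refine (Set.ncard_le_ncard (t := insert p (children par v : Set V)) ?_ (Set.toFinite _)).trans
      (Set.ncard_insert_le _ _)
    intro w hw
    rcases hp.adj_iff.1 hw with h | h
    · exact Or.inl (Option.some.inj (h.symm.trans hv))
    · exact Or.inr (by simpa [children] using h)

lemma deg_root_le {V : Type} [Fintype V] [DecidableEq V] {par : V → Option V}
    (hp : Grounded par) {v : V} (hv : par v = none) :
    deg (toGraph par) v ≤ (children par v).card := by
  rw [deg, ← Set.ncard_coe_finset]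
  refine Set.ncard_le_ncard (fun w hw => ?_) (Set.toFinite _)
  rcases hp.adj_iff.1 hw with h | h
  · simp [hv] at h
  · simpa [children] using h

lemma not_reachable_of_roots {V : Type} {par : V → Option V} (hp : Grounded par) {x y : V}
    (hx : par x = none) (hy : par y = none) (hxy : x ≠ y) : ¬ (toGraph par).Reachable x y := by
  intro h
  rcases ReflTransGen.cases_head (reflTransGen_of_reachable hp hy h) with h1 | ⟨z, hz, -⟩
  · exact hxy h1
  · exact absurd (hx.symm.trans hz) (by simp)

lemma grounded_of_lt {n : ℕ} {par : Fin n → Option (Fin n)} (h : ∀ x y, par x = some y → y < x) :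
    Grounded par :=
  Subrelation.wf (fun {y x} hyx => h x y hyx) (wellFounded_lt (α := Fin n))

/-- A rooted forest in which parents are smaller than their children can be built by inserting the
edges to the parents in the order of the vertices. -/
lemma exists_build {n Δ : ℕ} {par : Fin n → Option (Fin n)} (h : ∀ x y, par x = some y → y < x)
    (hd : ∀ x, (children par x).card + 1 ≤ Δ) :
    ∃ us, LegalRooted Δ us ∧ rootedAfter us = par := by
  suffices H : ∀ k ≤ n, ∃ us, LegalRooted Δ us ∧
      rootedAfter us = fun x : Fin n => if (x : ℕ) < k then par x else none by
    obtain ⟨us, h1, h2⟩ := H n le_rfl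
    refine ⟨us, h1, h2.trans ?_⟩
    funext x
    exact if_pos x.2
  intro k
  induction k with
  | zero => exact fun _ => ⟨[], fun t => t.elim0, by ext x; simp [rootedAfter]⟩
  | succ k ih =>
    intro hk
    obtain ⟨us, h1, h2⟩ := ih (by omega)
    set v : Fin n := ⟨k, by omega⟩ with hv
    have hstep : (fun x : Fin n => if (x : ℕ) < k + 1 then par x else none) =
        Function.update (fun x : Fin n => if (x : ℕ) < k then par x else none) v (par v) := by
      ext x : 1
      by_cases hx : x = v
      · subst hx
        simp [hv]
      · rw [Function.update_of_ne hx]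
        have : (x : ℕ) ≠ k := fun h => hx (Fin.ext h)
        split_ifs <;> first | rfl | omega
    rw [hstep]
    set par' : Fin n → Option (Fin n) := fun x => if (x : ℕ) < k then par x else none with hpar'
    have hle : ∀ x y, par' x = some y → (x : ℕ) < k ∧ par x = some y := by
      intro x y hxy
      simp only [hpar'] at hxy
      split_ifs at hxy with hx
      exact ⟨hx, hxy⟩
    have hg : Grounded par' := grounded_of_lt fun x y hxy => h x y (hle x y hxy).2
    have hv0 : par' v = none := by simp [hpar', hv]
    rcases hvp : par v with _ | p
    · refine ⟨us, h1, ?_⟩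
      rw [h2, ← hv0, Function.update_eq_self]
    · have hpv : p < v := h v p hvp
      have hcv : children par' v = ∅ := by
        refine Finset.eq_empty_of_forall_notMem fun x hx => ?_
        obtain ⟨h3, h4⟩ := hle x v (by simpa [children] using hx)
        have h5 : (v : ℕ) < x := h x v h4
        simp only [hv] at h5
        omega
      refine ⟨us ++ [Update.insert p v], legalRooted_append_singleton.2 ⟨h1, ?_⟩, ?_⟩
      · rw [h2]
        refine ⟨hv0, fun hreach => ?_, ?_, ?_⟩
        · rcases ReflTransGen.cases_tail (reflTransGen_of_reachable hg hv0 hreach) with h3 | ⟨z, -, hz⟩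
          · exact hpv.ne' h3
          · have : z ∈ children par' v := by simpa [children] using hz
            simp [hcv] at this
        · have hlt : (children par' p).card < (children par p).card := by
            refine Finset.card_lt_card (Finset.ssubset_iff_of_subset ?_ |>.2 ⟨v, ?_, ?_⟩)
            · intro x hx
              simp only [children, Finset.mem_filter, Finset.mem_univ, true_and] at hx ⊢
              exact (hle x p hx).2
            · simpa [children] using hvp
            · simp [children, hv0]
          have := deg_le_card_children hg p
          have := hd p
          omega
        · have := deg_root_le hg hv0
          have := hd v
          rw [hcv, Finset.card_empty] at *
          omega
      · rw [rootedAfter_append_singleton, h2, applyRooted]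

/-- The first number of level `j` when the vertices of two complete `d`-ary trees are numbered level
by level, so that the children of `x` are `d * x + 2, …, d * x + d + 1`. -/
def levelStart (d : ℕ) : ℕ → ℕ
  | 0 => 0
  | j + 1 => d * levelStart d j + 2

lemma levelStart_lt_succ {d : ℕ} (hd : 2 ≤ d) (j : ℕ) : levelStart d j < levelStart d (j + 1) := by
  rw [levelStart]
  nlinarith [Nat.zero_le (levelStart d j)]

lemma levelStart_strictMono {d : ℕ} (hd : 2 ≤ d) : StrictMono (levelStart d) :=
  strictMono_nat_of_lt_succ (levelStart_lt_succ hd)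

lemma levelStart_le {d : ℕ} (hd : 2 ≤ d) (j : ℕ) : levelStart d j + 2 ≤ 2 * d ^ j := by
  induction j with
  | zero => simp [levelStart]
  | succ j ih =>
    rw [levelStart, pow_succ]
    nlinarith

/-- The parent map of two complete `d`-ary trees on the vertices less than `N`. -/
def twoTrees (d N n : ℕ) : Fin n → Option (Fin n) := fun x =>
  if 2 ≤ (x : ℕ) ∧ (x : ℕ) < N then
    some ⟨((x : ℕ) - 2) / d, (Nat.div_le_self _ _).trans_lt (by omega)⟩
  else none

lemma twoTrees_eq_some {d N n : ℕ} (hd : 0 < d) {x y : Fin n} :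
    twoTrees d N n x = some y ↔ d * y + 2 ≤ (x : ℕ) ∧ (x : ℕ) < d * y + d + 2 ∧ (x : ℕ) < N := by
  rw [twoTrees]
  split_ifs with h
  · rw [Option.some.injEq, Fin.ext_iff]
    simp only
    rw [Nat.div_eq_iff hd]
    constructor
    · rintro ⟨h1, h2⟩
      rw [mul_comm d]
      omega
    · rintro ⟨h1, h2, h3⟩
      rw [mul_comm d] at h1 h2
      omega
  · simp only [false_iff]
    rintro ⟨h1, h2, h3⟩
    exact h ⟨by omega, h3⟩

lemma twoTrees_lt {d N n : ℕ} (hd : 0 < d) (x y : Fin n) (h : twoTrees d N n x = some y) :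
    y < x := by
  rw [twoTrees_eq_some hd] at h
  have : (y : ℕ) ≤ d * y := Nat.le_mul_of_pos_left _ hd
  exact Fin.lt_def.2 (by omega)

lemma card_children_twoTrees_le {d N n : ℕ} (hd : 0 < d) (x : Fin n) :
    (children (twoTrees d N n) x).card ≤ d := by
  have h : (children (twoTrees d N n) x).map Fin.valEmbedding ⊆
      Finset.Ico (d * x + 2) (d * x + d + 2) := by
    intro z hz
    simp only [children, Finset.mem_map, Finset.mem_filter, Finset.mem_univ, true_and,
      twoTrees_eq_some hd, Fin.valEmbedding_apply] at hz
    obtain ⟨w, hw, rfl⟩ := hz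
    exact Finset.mem_Ico.2 ⟨hw.1, hw.2.1⟩
  have := Finset.card_le_card h
  rw [Finset.card_map, Nat.card_Ico] at this
  omega

lemma isCompleteTree_twoTrees {d n h : ℕ} (hd : 2 ≤ d) (hn : levelStart d (h + 1) ≤ n) {i j : ℕ}
    (hij : j + i = h) (x : Fin n) (h1 : levelStart d j ≤ x) (h2 : (x : ℕ) < levelStart d (j + 1)) :
    IsCompleteTree (twoTrees d (levelStart d (h + 1)) n) d i x := by
  have hd0 : 0 < d := by omega
  have hlo : levelStart d (j + 1) ≤ d * x + 2 := by
    rw [levelStart]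
    gcongr
  have hhi : d * x + d + 2 ≤ levelStart d (j + 2) := by
    rw [levelStart]
    have := Nat.mul_le_mul_left d (show (x : ℕ) + 1 ≤ levelStart d (j + 1) from h2)
    rw [mul_add] at this
    omega
  induction i generalizing j x with
  | zero =>
    rw [IsCompleteTree]
    refine Finset.eq_empty_of_forall_notMem fun z hz => ?_
    simp only [children, Finset.mem_filter, Finset.mem_univ, true_and, twoTrees_eq_some hd0] at hz
    obtain rfl : j = h := by omega
    omega
  | succ i ih =>
    have hN : levelStart d (j + 2) ≤ levelStart d (h + 1) :=
      (levelStart_strictMono hd).monotone (by omega)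
    have hmem : ∀ z, z ∈ children (twoTrees d (levelStart d (h + 1)) n) x ↔
        d * x + 2 ≤ (z : ℕ) ∧ (z : ℕ) < d * x + d + 2 := by
      intro z
      simp only [children, Finset.mem_filter, Finset.mem_univ, true_and, twoTrees_eq_some hd0]
      omega
    refine ⟨?_, fun z hz => ?_⟩
    · have h3 : (children (twoTrees d (levelStart d (h + 1)) n) x).map Fin.valEmbedding =
          Finset.Ico (d * x + 2) (d * x + d + 2) := by
        ext z
        simp only [Finset.mem_map, hmem, Fin.valEmbedding_apply, Finset.mem_Ico]
        constructor
        · rintro ⟨w, hw, rfl⟩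
          exact hw
        · intro hz
          exact ⟨⟨z, by omega⟩, hz, rfl⟩
      have h4 := congrArg Finset.card h3
      rw [Finset.card_map, Nat.card_Ico] at h4
      omega
    · rw [hmem] at hz
      have h3 : levelStart d (j + 1) ≤ z := by omega
      have h4 : (z : ℕ) < levelStart d (j + 2) := by omega
      refine ih (j := j + 1) (by omega) z h3 h4 ?_ ?_
      · rw [levelStart]
        gcongr
      · rw [levelStart]
        have := Nat.mul_le_mul_left d (show (z : ℕ) + 1 ≤ levelStart d (j + 2) from h4)
        rw [mul_add] at this
        omega

/-- The largest height for which two complete `d`-ary trees fit into `n` vertices. -/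
lemma exists_height {d n : ℕ} (hd : 2 ≤ d) (hn : 2 * (d + 1) ≤ n) :
    ∃ h, 1 ≤ h ∧ h ≤ n ∧ levelStart d (h + 1) ≤ n ∧ n ≤ d ^ (h + 3) := by
  have hex : ∃ j, n < levelStart d j := by
    refine ⟨n + 1, ?_⟩
    have := (levelStart_strictMono hd).id_le (n + 1)
    exact Nat.lt_of_succ_le this
  classical
  have h2 : ∀ j ≤ 2, ¬ n < levelStart d j := by
    intro j hj hlt
    have h3 := (levelStart_strictMono hd).monotone hj
    have h4 : levelStart d 2 = d * (d * 0 + 2) + 2 := rfl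
    omega
  have h3 := Nat.find_spec hex
  have h4 : ∀ j < Nat.find hex, ¬ n < levelStart d j := fun j hj => Nat.find_min hex hj
  generalize Nat.find hex = k at h3 h4
  have hk : 3 ≤ k := by
    by_contra hk
    exact h2 k (by omega) h3
  obtain ⟨h, rfl⟩ : ∃ h, k = h + 2 := ⟨k - 2, by omega⟩
  have h5 : levelStart d (h + 1) ≤ n := not_lt.1 (h4 (h + 1) (by omega))
  refine ⟨h, by omega, ?_, h5, ?_⟩
  · have : h + 1 ≤ levelStart d (h + 1) := (levelStart_strictMono hd).id_le (h + 1)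
    omega
  · have h6 := levelStart_le hd (h + 2)
    have h7 : 2 * d ^ (h + 2) ≤ d ^ (h + 3) := by
      rw [pow_succ d (h + 2), mul_comm]
      exact Nat.mul_le_mul_left _ hd
    omega

end Build

/-! ### Expected recourse of the two algorithms -/

section Algorithms

variable {V : Type} {κ : ℕ}

lemma stateLaw_append_singleton (step : State V κ → Update V → PMF (State V κ))
    (us : List (Update V)) (u : Update V) :
    stateLaw step (us ++ [u]) = (stateLaw step us).bind fun s => step s u := by
  simp [stateLaw]

variable [DecidableEq V]

lemma attachable_reroot {Δ : ℕ} {par : V → Option V} (hg : Grounded par) {u v p r : V}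
    (h : LegalUpdate Δ (toGraph par) (Update.insert u v))
    (hpr : p = u ∧ r = v ∨ p = v ∧ r = u) :
    Attachable (reroot par r) p r ∧ deg (toGraph (reroot par r)) p < Δ ∧
      deg (toGraph (reroot par r)) r < Δ ∧
      toGraph (Function.update (reroot par r) r (some p)) =
        applyUpdate (toGraph par) (Update.insert u v) := by
  rw [hg.toGraph_reroot]
  have hA : Attachable (reroot par r) p r := by
    refine ⟨hg.reroot r, reroot_self r, ?_⟩
    rw [hg.toGraph_reroot]
    rcases hpr with ⟨rfl, rfl⟩ | ⟨rfl, rfl⟩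
    · exact h.1
    · exact fun h' => h.1 h'.symm
  refine ⟨hA, ?_, ?_, ?_⟩
  · rcases hpr with ⟨rfl, rfl⟩ | ⟨rfl, rfl⟩
    · exact h.2.1
    · exact h.2.2
  · rcases hpr with ⟨rfl, rfl⟩ | ⟨rfl, rfl⟩
    · exact h.2.2
    · exact h.2.1
  · rw [toGraph_update_some hA.root hA.ne, hg.toGraph_reroot, applyUpdate]
    rcases hpr with ⟨rfl, rfl⟩ | ⟨rfl, rfl⟩
    · rfl
    · rw [SimpleGraph.edge_comm]

variable [Fintype V]

/-- In the rooted version, the coloring is uniformly distributed at all times. -/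
lemma isUniform_rooted {Δ : ℕ} (hκ : Δ ≤ κ) {us : List (Update V)} (h : LegalRooted Δ us) :
    IsUniform (stateLaw (rootedStep (κ := κ)) us) (rootedAfter us) := by
  induction us using List.reverseRecOn with
  | nil => exact isUniform_init
  | append_singleton us u ih =>
    obtain ⟨h1, h2⟩ := legalRooted_append_singleton.1 h
    obtain ⟨hg, hG, hl⟩ := legal_of_legalRooted h1
    rw [stateLaw_append_singleton, rootedAfter_append_singleton]
    cases u with
    | insert p r =>
      have hA : Attachable (rootedAfter us) p r := ⟨hg, h2.1, h2.2.1⟩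
      exact hA.isUniform_attach (h2.2.2.1.trans_le hκ) (h2.2.2.2.trans_le hκ) rfl (ih h1)
        fun c => rfl
    | delete p r =>
      have hA := attachable_update_none hg h2
      have hpar : Function.update (Function.update (rootedAfter us) r none) r (some p) =
          rootedAfter us := by
        rw [Function.update_idem, ← h2, Function.update_eq_self]
      refine hA.isUniform_detach (by rw [hpar]; exact ih h1) fun c => rfl

lemma expectedRecourse_rooted_insert {Δ : ℕ} (hκ : Δ ≤ κ) (hκ2 : 2 ≤ κ) {us : List (Update V)}
    {p r : V} (h : LegalRooted Δ (us ++ [Update.insert p r])) :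
    expectedRecourse (rootedStep (κ := κ)) us (Update.insert p r) =
      (κ : ℝ≥0∞)⁻¹ * levelSum κ (Function.update (rootedAfter us) r (some p)) r := by
  obtain ⟨h1, h2⟩ := legalRooted_append_singleton.1 h
  obtain ⟨hg, -, -⟩ := legal_of_legalRooted h1
  have hA : Attachable (rootedAfter us) p r := ⟨hg, h2.1, h2.2.1⟩
  exact hA.expect_recourse_attach hκ2 (h2.2.2.1.trans_le hκ) (h2.2.2.2.trans_le hκ) rfl
    (isUniform_rooted hκ h1) fun c => rfl

/-- The expected recourse of an update in the rooted version, in terms of the forest `par` in which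
the inserted or deleted edge between `r` and its parent `p` is present. -/
lemma exists_expectedRecourse_rooted {Δ : ℕ} (hκ : Δ ≤ κ) (hκ2 : 2 ≤ κ) {us : List (Update V)}
    {u : Update V} (h : LegalRooted Δ (us ++ [u])) :
    ∃ (par : V → Option V) (p r : V), Grounded par ∧ par r = some p ∧
      (∀ v, deg (toGraph par) v ≤ Δ) ∧
      expectedRecourse (rootedStep (κ := κ)) us u = (κ : ℝ≥0∞)⁻¹ * levelSum κ par r := by
  obtain ⟨h1, h2⟩ := legalRooted_append_singleton.1 h
  obtain ⟨hg, hG, hl⟩ := legal_of_legalRooted h1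
  obtain ⟨hg', hG', hl'⟩ := legal_of_legalRooted h
  cases u with
  | insert p r =>
    rw [rootedAfter_append_singleton] at hg' hG'
    exact ⟨_, p, r, hg', by simp [applyRooted],
      fun v => by rw [hG']; exact deg_forestAfter_le hl' v, expectedRecourse_rooted_insert hκ hκ2 h⟩
  | delete p r =>
    have hA := attachable_update_none hg h2
    have hpar : Function.update (Function.update (rootedAfter us) r none) r (some p) =
        rootedAfter us := by
      rw [Function.update_idem, ← h2, Function.update_eq_self]
    have h3 := hA.expect_recourse_detach hκ2 (μ := stateLaw (rootedStep (κ := κ)) us)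
      (step := fun s => rootedStep s (Update.delete p r))
      (by rw [hpar]; exact isUniform_rooted hκ h1) fun c => rfl
    rw [hpar] at h3
    exact ⟨rootedAfter us, p, r, hg, h2, fun v => by rw [hG]; exact deg_forestAfter_le hl v, h3⟩

/-- An insertion of the unrooted version is a rooted insertion into a rerooted forest. -/
lemma exists_unrootedStep_insert (Δ : ℕ) (tie : TieRule V) (par : V → Option V) (u v : V) :
    ∃ p r, (p = u ∧ r = v ∨ p = v ∧ r = u) ∧ ∀ c : Coloring V κ,
      unrootedStep Δ tie ⟨par, c⟩ (Update.insert u v) = attach ⟨reroot par r, c⟩ p r := by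
  by_cases h : MayBeChild Δ (toGraph par) u v ∧
      (MayBeChild Δ (toGraph par) v u → tie par u v = true)
  · exact ⟨u, v, Or.inl ⟨rfl, rfl⟩, fun c => if_pos h⟩
  · exact ⟨v, u, Or.inr ⟨rfl, rfl⟩, fun c => if_neg h⟩

lemma exists_unrootedStep_delete (Δ : ℕ) (tie : TieRule V) {par : V → Option V} {u v : V}
    (h : par v = some u ∨ par u = some v) :
    ∃ p r, (p = u ∧ r = v ∨ p = v ∧ r = u) ∧ par r = some p ∧ ∀ c : Coloring V κ,
      unrootedStep Δ tie ⟨par, c⟩ (Update.delete u v) = detach ⟨par, c⟩ p r := by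
  by_cases hv : par v = some u
  · exact ⟨u, v, Or.inl ⟨rfl, rfl⟩, hv, fun c => if_pos hv⟩
  · exact ⟨v, u, Or.inr ⟨rfl, rfl⟩, h.resolve_left hv, fun c => if_neg hv⟩

/-- In the unrooted version, the rooting is deterministic, and the coloring is uniformly distributed
at all times. -/
lemma isUniform_unrooted {Δ : ℕ} (hκ : Δ ≤ κ) (tie : TieRule V) {us : List (Update V)}
    (h : Legal Δ us) : ∃ par, Grounded par ∧ toGraph par = forestAfter us ∧
      IsUniform (stateLaw (unrootedStep (κ := κ) Δ tie) us) par := by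
  induction us using List.reverseRecOn with
  | nil => exact ⟨_, grounded_none, toGraph_none, isUniform_init⟩
  | append_singleton us u ih =>
    obtain ⟨h1, h2⟩ := legal_append_singleton.1 h
    obtain ⟨par, hg, hG, hu⟩ := ih h1
    rw [stateLaw_append_singleton, forestAfter_append_singleton]
    rw [← hG] at h2 ⊢
    cases u with
    | insert u v =>
      obtain ⟨p, r, hpr, hstep⟩ := exists_unrootedStep_insert (κ := κ) Δ tie par u v
      obtain ⟨hA, hp, hr, hG'⟩ := attachable_reroot hg h2 hpr
      exact ⟨_, hA.grounded_update, hG', hA.isUniform_attach (hp.trans_le hκ) (hr.trans_le hκ)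
        (hg.toGraph_reroot r).symm hu hstep⟩
    | delete u v =>
      obtain ⟨p, r, hpr, hr, hstep⟩ :=
        exists_unrootedStep_delete (κ := κ) Δ tie (hg.adj_iff.1 h2).symm
      have hpar : Function.update (Function.update par r none) r (some p) = par := by
        rw [Function.update_idem, ← hr, Function.update_eq_self]
      refine ⟨_, hg.update_none r, ?_, (attachable_update_none hg hr).isUniform_detach
        (by rw [hpar]; exact hu) (by rw [hpar]; exact hstep)⟩
      rw [toGraph_update_none hg hr, applyUpdate]
      rcases hpr with ⟨rfl, rfl⟩ | ⟨rfl, rfl⟩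
      · rfl
      · rw [Sym2.eq_swap]

/-- The expected recourse of an insertion in the unrooted version, in terms of the forest in which
the tree of the new child has been rerooted. -/
lemma exists_expectedRecourse_unrooted_insert {Δ : ℕ} (hκ : Δ ≤ κ) (hκ2 : 2 ≤ κ) (tie : TieRule V)
    {us : List (Update V)} {u v : V} (h : Legal Δ (us ++ [Update.insert u v])) :
    ∃ (par : V → Option V) (p r : V), Attachable par p r ∧ (r = u ∨ r = v) ∧
      toGraph par = forestAfter us ∧
      toGraph (Function.update par r (some p)) = forestAfter (us ++ [Update.insert u v]) ∧
      expectedRecourse (unrootedStep (κ := κ) Δ tie) us (Update.insert u v) =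
        (κ : ℝ≥0∞)⁻¹ * levelSum κ (Function.update par r (some p)) r := by
  obtain ⟨h1, h2⟩ := legal_append_singleton.1 h
  obtain ⟨par, hg, hG, hu⟩ := isUniform_unrooted hκ tie h1
  rw [forestAfter_append_singleton, ← hG]
  rw [← hG] at h2
  obtain ⟨p, r, hpr, hstep⟩ := exists_unrootedStep_insert (κ := κ) Δ tie par u v
  obtain ⟨hA, hp, hr, hG'⟩ := attachable_reroot hg h2 hpr
  refine ⟨_, p, r, hA, by tauto, hg.toGraph_reroot r, hG', ?_⟩
  exact hA.expect_recourse_attach hκ2 (hp.trans_le hκ) (hr.trans_le hκ)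
    (hg.toGraph_reroot r).symm hu hstep

/-- The expected recourse of an update in the unrooted version, in terms of the forest `par` in which
the inserted or deleted edge between `r` and its parent `p` is present. -/
lemma exists_expectedRecourse_unrooted {Δ : ℕ} (hκ : Δ ≤ κ) (hκ2 : 2 ≤ κ) (tie : TieRule V)
    {us : List (Update V)} {u : Update V} (h : Legal Δ (us ++ [u])) :
    ∃ (par : V → Option V) (p r : V), Grounded par ∧ par r = some p ∧
      (∀ v, deg (toGraph par) v ≤ Δ) ∧
      expectedRecourse (unrootedStep (κ := κ) Δ tie) us u = (κ : ℝ≥0∞)⁻¹ * levelSum κ par r := by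
  obtain ⟨h1, h2⟩ := legal_append_singleton.1 h
  cases u with
  | insert u v =>
    obtain ⟨par, p, r, hA, -, -, hG, he⟩ := exists_expectedRecourse_unrooted_insert hκ hκ2 tie h
    exact ⟨_, p, r, hA.grounded_update, by simp,
      fun w => by rw [hG]; exact deg_forestAfter_le h w, he⟩
  | delete u v =>
    obtain ⟨par, hg, hG, hu⟩ := isUniform_unrooted hκ tie h1
    rw [← hG] at h2
    obtain ⟨p, r, hpr, hr, hstep⟩ :=
      exists_unrootedStep_delete (κ := κ) Δ tie (hg.adj_iff.1 h2).symm
    have hpar : Function.update (Function.update par r none) r (some p) = par := by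
      rw [Function.update_idem, ← hr, Function.update_eq_self]
    have h3 := (attachable_update_none hg hr).expect_recourse_detach hκ2
      (μ := stateLaw (unrootedStep (κ := κ) Δ tie) us)
      (step := fun s => unrootedStep Δ tie s (Update.delete u v))
      (by rw [hpar]; exact hu) (by rw [hpar]; exact hstep)
    rw [hpar] at h3
    exact ⟨par, p, r, hg, hr, fun v => by rw [hG]; exact deg_forestAfter_le h1 v, h3⟩

lemma card_children_add_one_le {par : V → Option V} (hg : Grounded par) {v w : V}
    (hv : par v = some w) : (children par v).card + 1 ≤ deg (toGraph par) v := by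
  have hw : w ∉ children par v := by
    simpa [children] using hg.asymm hv
  rw [← Finset.card_insert_of_notMem hw, deg, ← Set.ncard_coe_finset]
  refine Set.ncard_le_ncard (fun x hx => ?_) (Set.toFinite _)
  rw [Finset.mem_coe, Finset.mem_insert] at hx
  rcases hx with rfl | hx
  · exact hg.adj_iff.2 (Or.inl hv)
  · exact hg.adj_iff.2 (Or.inr (by simpa [children] using hx))

lemma card_level_le {Δ : ℕ} {par : V → Option V} (hg : Grounded par)
    (hd : ∀ v, deg (toGraph par) v ≤ Δ) {p r : V} (hr : par r = some p) (i : ℕ) :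
    (level par i r).card ≤ (Δ - 1) ^ i := by
  induction i with
  | zero => simp [level]
  | succ i ih =>
    refine (card_level_succ_le (d := Δ - 1) fun x hx => ?_).trans ?_
    · obtain ⟨y, hy⟩ : ∃ y, par x = some y := by
        cases i with
        | zero =>
          obtain rfl : x = r := by simpa [level] using hx
          exact ⟨p, hr⟩
        | succ i =>
          obtain ⟨y, -, hy⟩ := mem_level_succ.1 hx
          exact ⟨y, hy⟩
      have h1 := card_children_add_one_le hg hy
      have h2 := hd x
      omega
    · rw [pow_succ]
      exact Nat.mul_le_mul_right _ ih

lemma inv_mul_levelSum_eq {Δ c : ℕ} (hΔ : 3 ≤ Δ) (par : V → Option V) (r : V) :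
    ((Δ + c : ℕ) : ℝ≥0∞)⁻¹ * levelSum (Δ + c) par r =
      ENNReal.ofReal (((Δ + c : ℕ) : ℝ)⁻¹ * ∑ i ∈ Finset.range (Fintype.card V),
        ((level par (i + 1) r).card : ℝ) / ((Δ : ℝ) + c - 1) ^ i) := by
  have hΔ' : (3 : ℝ) ≤ Δ := by exact_mod_cast hΔ
  have hc0 : (0 : ℝ) ≤ c := Nat.cast_nonneg c
  have hK : (0 : ℝ) < (Δ : ℝ) + c - 1 := by linarith
  rw [ENNReal.ofReal_mul (by positivity), ENNReal.ofReal_inv_of_pos (by positivity),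
    ENNReal.ofReal_natCast, ENNReal.ofReal_sum_of_nonneg fun i _ => by positivity, levelSum]
  refine congrArg _ (Finset.sum_congr rfl fun i _ => ?_)
  rw [ENNReal.ofReal_div_of_pos (by positivity), ENNReal.ofReal_natCast,
    ENNReal.ofReal_pow hK.le, ENNReal.ofReal_sub _ zero_le_one, ENNReal.ofReal_one]
  congr 3
  rw [← ENNReal.ofReal_natCast]
  push_cast
  rfl

lemma inv_mul_levelSum_le {Δ c : ℕ} (hΔ : 3 ≤ Δ) {par : V → Option V} (hg : Grounded par)
    (hd : ∀ v, deg (toGraph par) v ≤ Δ) {p r : V} (hr : par r = some p) :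
    ((Δ + c : ℕ) : ℝ≥0∞)⁻¹ * levelSum (Δ + c) par r ≤
      ENNReal.ofReal (recourseBound Δ c (Fintype.card V)) := by
  rw [inv_mul_levelSum_eq hΔ]
  refine ENNReal.ofReal_le_ofReal (sum_level_le hΔ (Fintype.card_pos_iff.2 ⟨r⟩)
    (fun i => card_level_le hg hd hr (i + 1)) ?_)
  have h1 := hg.sum_card_level_le r ((Finset.range (Fintype.card V)).image (· + 1))
  rwa [Finset.sum_image fun _ _ _ _ h => Nat.succ_injective h] at h1

lemma le_inv_mul_levelSum {Δ c h : ℕ} (hΔ : 3 ≤ Δ) (hc : c + 2 ≤ Δ) (hh : 1 ≤ h)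
    (hhn : h ≤ Fintype.card V) (hn : Fintype.card V ≤ (Δ - 1) ^ (h + 3)) {par : V → Option V} {r : V}
    (hl : ∀ i ≤ h, (Δ - 1) ^ i ≤ (level par i r).card) :
    ENNReal.ofReal (1 / 16 * recourseOrder Δ c (Fintype.card V)) ≤
      ((Δ + c : ℕ) : ℝ≥0∞)⁻¹ * levelSum (Δ + c) par r := by
  rw [inv_mul_levelSum_eq hΔ]
  exact ENNReal.ofReal_le_ofReal (le_sum_level hΔ hc (hh.trans hhn) hh hn hhn
    fun i hi => hl (i + 1) hi)

lemma level_subset_update {par : V → Option V} {p r : V} (hr : par r = none) (i : ℕ) :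
    level par i r ⊆ level (Function.update par r (some p)) i r := by
  induction i with
  | zero => simp [level]
  | succ i ih =>
    intro x hx
    obtain ⟨y, hy, hxy⟩ := mem_level_succ.1 hx
    have hxr : x ≠ r := by
      rintro rfl
      simp [hr] at hxy
    exact mem_level_succ.2 ⟨y, ih hy, by rwa [Function.update_of_ne hxr]⟩

end Algorithms

/-! ### Amortization -/

section Amortization

variable {V : Type} [Fintype V] {κ : ℕ}

/-- The total expected recourse of a sequence of updates. -/
noncomputable def totalRecourse (step : State V κ → Update V → PMF (State V κ))
    (us : List (Update V)) : ℝ≥0∞ :=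
  ∑ t : Fin us.length, expectedRecourse step (us.take t) (us.get t)

lemma totalRecourse_append_singleton (step : State V κ → Update V → PMF (State V κ))
    (us : List (Update V)) (u : Update V) :
    totalRecourse step (us ++ [u]) = totalRecourse step us + expectedRecourse step us u := by
  have hlen : (us ++ [u]).length = us.length + 1 := by simp
  rw [totalRecourse, ← Equiv.sum_comp (finCongr hlen.symm), Fin.sum_univ_castSucc]
  congr 1
  · refine Finset.sum_congr rfl fun t _ => ?_
    simp [List.take_append_of_le_length t.2.le]
  · simp

lemma le_totalRecourse {step : State V κ → Update V → PMF (State V κ)} {us : List (Update V)}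
    {r₁ r₂ : V} {x : ℝ≥0∞}
    (h : ∀ m, x ≤ expectedRecourse step (us ++ relink r₁ r₂ m) (Update.insert r₁ r₂)) (m : ℕ) :
    m * x ≤ totalRecourse step (us ++ relink r₁ r₂ m) := by
  induction m with
  | zero => simp
  | succ m ih =>
    rw [relink_succ, ← List.append_assoc, ← List.append_assoc, totalRecourse_append_singleton,
      totalRecourse_append_singleton, Nat.cast_succ, add_mul, one_mul]
    exact (add_le_add ih (h m)).trans le_self_add

/-- If every insertion of the repeated edge has expected recourse at least `x`, then in the long run
the average over all updates is at least `x / 3`. -/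
lemma le_amortizedRecourse {step : State V κ → Update V → PMF (State V κ)} {us : List (Update V)}
    {r₁ r₂ : V} {x : ℝ≥0∞}
    (h : ∀ m, 3 * x ≤ expectedRecourse step (us ++ relink r₁ r₂ m) (Update.insert r₁ r₂)) {m : ℕ}
    (hm : us.length + 1 ≤ m) : x ≤ amortizedRecourse step (us ++ relink r₁ r₂ m) := by
  -- for `m > us.length`, the `m` insertions make up at least a third of the nonempty sequence
  have hlen : (us ++ relink r₁ r₂ m).length = us.length + m * 2 := by
    simp [relink]
  have h1 := le_totalRecourse h m
  change x ≤ totalRecourse step (us ++ relink r₁ r₂ m) / _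
  rw [ENNReal.le_div_iff_mul_le (Or.inl (by rw [hlen]; simp; omega))
    (Or.inl (ENNReal.natCast_ne_top _))]
  refine le_trans ?_ h1
  rw [mul_comm, ← mul_assoc]
  refine mul_le_mul_left ?_ x
  rw [hlen]
  exact_mod_cast (by omega : us.length + m * 2 ≤ m * 3)

end Amortization

/-! ### Tightness -/

section Tightness

/-- A sequence that builds two complete `(Δ - 1)`-ary trees whose height is the largest possible for
`n` vertices. -/
lemma exists_build_twoTrees {Δ n : ℕ} (hΔ : 3 ≤ Δ) (hn : 2 * Δ ≤ n) :
    ∃ (h : ℕ) (r₁ r₂ : Fin n) (build : List (Update (Fin n))),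
      1 ≤ h ∧ h ≤ n ∧ n ≤ (Δ - 1) ^ (h + 3) ∧ r₁ ≠ r₂ ∧
      rootedAfter build r₁ = none ∧ rootedAfter build r₂ = none ∧
      IsCompleteTree (rootedAfter build) (Δ - 1) h r₁ ∧
      IsCompleteTree (rootedAfter build) (Δ - 1) h r₂ ∧
      LegalRooted Δ build ∧
      LegalRootedUpdate Δ (rootedAfter build) (Update.insert r₁ r₂) := by
  obtain ⟨h, h1, h2, h3, h4⟩ := exists_height (d := Δ - 1) (n := n) (by omega) (by omega)
  have hd : 0 < Δ - 1 := by omega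
  obtain ⟨build, hb, hpar⟩ := exists_build (Δ := Δ)
    (twoTrees_lt (N := levelStart (Δ - 1) (h + 1)) (n := n) hd)
    (fun x => by have := card_children_twoTrees_le (N := levelStart (Δ - 1) (h + 1)) hd x; omega)
  have hroot : ∀ x : Fin n, (x : ℕ) < 2 → rootedAfter build x = none := by
    intro x hx
    rw [hpar, twoTrees, if_neg (by omega)]
  have htree : ∀ x : Fin n, (x : ℕ) < 2 → IsCompleteTree (rootedAfter build) (Δ - 1) h x := by
    intro x hx
    rw [hpar]
    exact isCompleteTree_twoTrees (j := 0) (by omega) h3 (by omega) x (by simp [levelStart])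
      (by simpa [levelStart] using hx)
  have hg := (legal_of_legalRooted hb).1
  have hdeg : ∀ x : Fin n, (x : ℕ) < 2 → deg (toGraph (rootedAfter build)) x < Δ := by
    intro x hx
    have h5 := deg_root_le hg (hroot x hx)
    have h6 : (children (rootedAfter build) x).card ≤ Δ - 1 := by
      rw [hpar]
      exact card_children_twoTrees_le hd x
    omega
  have hne : (⟨0, by omega⟩ : Fin n) ≠ ⟨1, by omega⟩ := by simp
  exact ⟨h, ⟨0, by omega⟩, ⟨1, by omega⟩, build, h1, h2, h4, hne, hroot _ (by simp),
    hroot _ (by simp), htree _ (by simp), htree _ (by simp), hb, hroot _ (by simp),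
    not_reachable_of_roots hg (hroot _ (by simp)) (hroot _ (by simp)) hne, hdeg _ (by simp),
    hdeg _ (by simp)⟩

end Tightness

end DistMaint

open DistMaint

theorem mainTheorem7 :
    -- the explicit upper bound, for every update of every admissible sequence
    (∀ Δ c n : ℕ, 3 ≤ Δ → c + 2 ≤ Δ → ∀ (past : List (Update (Fin n))) (u : Update (Fin n)),
      (LegalRooted Δ (past ++ [u]) →
        expectedRecourse (rootedStep (κ := Δ + c)) past u
          ≤ ENNReal.ofReal (recourseBound Δ c n)) ∧
      (Legal Δ (past ++ [u]) → ∀ tie : TieRule (Fin n),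
        expectedRecourse (unrootedStep (κ := Δ + c) Δ tie) past u
          ≤ ENNReal.ofReal (recourseBound Δ c n))) ∧
    -- its order of magnitude, with an absolute constant
    (∃ C : ℝ, 0 < C ∧ ∀ Δ c n : ℕ, 3 ≤ Δ → c + 2 ≤ Δ → 2 * Δ ≤ n →
      ∀ (past : List (Update (Fin n))) (u : Update (Fin n)),
      (LegalRooted Δ (past ++ [u]) →
        expectedRecourse (rootedStep (κ := Δ + c)) past u
          ≤ ENNReal.ofReal (C * recourseOrder Δ c n)) ∧
      (Legal Δ (past ++ [u]) → ∀ tie : TieRule (Fin n),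
        expectedRecourse (unrootedStep (κ := Δ + c) Δ tie) past u
          ≤ ENNReal.ofReal (C * recourseOrder Δ c n))) ∧
    -- tightness: build two complete `(Δ - 1)`-ary trees, then link and cut their roots repeatedly
    (∃ C : ℝ, 0 < C ∧ ∀ Δ c n : ℕ, 3 ≤ Δ → c + 2 ≤ Δ → 2 * Δ ≤ n →
      ∃ (h : ℕ) (r₁ r₂ : Fin n) (build : List (Update (Fin n))),
        r₁ ≠ r₂ ∧ rootedAfter build r₁ = none ∧ rootedAfter build r₂ = none ∧
        IsCompleteTree (rootedAfter build) (Δ - 1) h r₁ ∧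
        IsCompleteTree (rootedAfter build) (Δ - 1) h r₂ ∧
        (∀ m : ℕ, LegalRooted Δ (build ++ relink r₁ r₂ m) ∧
          Legal Δ (build ++ relink r₁ r₂ m) ∧
          ENNReal.ofReal (C * recourseOrder Δ c n)
            ≤ expectedRecourse (rootedStep (κ := Δ + c)) (build ++ relink r₁ r₂ m)
                (Update.insert r₁ r₂) ∧
          ∀ tie : TieRule (Fin n), ENNReal.ofReal (C * recourseOrder Δ c n)
            ≤ expectedRecourse (unrootedStep (κ := Δ + c) Δ tie) (build ++ relink r₁ r₂ m)
                (Update.insert r₁ r₂)) ∧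
        ∃ m₀ : ℕ, ∀ m : ℕ, m₀ ≤ m →
          ENNReal.ofReal (C * recourseOrder Δ c n)
            ≤ amortizedRecourse (rootedStep (κ := Δ + c)) (build ++ relink r₁ r₂ m) ∧
          ∀ tie : TieRule (Fin n), ENNReal.ofReal (C * recourseOrder Δ c n)
            ≤ amortizedRecourse (unrootedStep (κ := Δ + c) Δ tie)
                (build ++ relink r₁ r₂ m)) := by
  refine ⟨?_, ⟨4, by norm_num, ?_⟩, ⟨1 / 48, by norm_num, ?_⟩⟩
  · intro Δ c n hΔ hc past u
    have hκ : Δ ≤ Δ + c := by omega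
    have hκ2 : 2 ≤ Δ + c := by omega
    constructor
    · intro h
      obtain ⟨par, p, r, hg, hr, hd, he⟩ := exists_expectedRecourse_rooted hκ hκ2 h
      rw [he]
      simpa using inv_mul_levelSum_le (c := c) hΔ hg hd hr
    · intro h tie
      obtain ⟨par, p, r, hg, hr, hd, he⟩ := exists_expectedRecourse_unrooted hκ hκ2 tie h
      rw [he]
      simpa using inv_mul_levelSum_le (c := c) hΔ hg hd hr
  · intro Δ c n hΔ hc hn past u
    have hκ : Δ ≤ Δ + c := by omega
    have hκ2 : 2 ≤ Δ + c := by omega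
    have hle := ENNReal.ofReal_le_ofReal (recourseBound_le hΔ hc hn)
    constructor
    · intro h
      obtain ⟨par, p, r, hg, hr, hd, he⟩ := exists_expectedRecourse_rooted hκ hκ2 h
      rw [he]
      exact le_trans (by simpa using inv_mul_levelSum_le (c := c) hΔ hg hd hr) hle
    · intro h tie
      obtain ⟨par, p, r, hg, hr, hd, he⟩ := exists_expectedRecourse_unrooted hκ hκ2 tie h
      rw [he]
      exact le_trans (by simpa using inv_mul_levelSum_le (c := c) hΔ hg hd hr) hle
  · intro Δ c n hΔ hc hn
    have hκ : Δ ≤ Δ + c := by omega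
    have hκ2 : 2 ≤ Δ + c := by omega
    obtain ⟨h, r₁, r₂, build, h1, hhn, hnh, hne, hr₁, hr₂, ht₁, ht₂, hb, hins⟩ :=
      exists_build_twoTrees hΔ hn
    have hrelink := legalRooted_relink hb hins
    have hnext : ∀ m, LegalRooted Δ (build ++ relink r₁ r₂ m ++ [Update.insert r₁ r₂]) := by
      intro m
      rw [legalRooted_append_singleton, (hrelink m).2]
      exact ⟨(hrelink m).1, hins⟩
    have hlow : ∀ (par : Fin n → Option (Fin n)) (r : Fin n),
        (∀ i ≤ h, (Δ - 1) ^ i ≤ (level par i r).card) →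
        ENNReal.ofReal (1 / 16 * recourseOrder Δ c n) ≤
          ((Δ + c : ℕ) : ℝ≥0∞)⁻¹ * levelSum (Δ + c) par r := by
      intro par r hl
      simpa using le_inv_mul_levelSum hΔ hc h1 (by simpa using hhn) (by simpa using hnh) hl
    have hrooted : ∀ m, ENNReal.ofReal (1 / 16 * recourseOrder Δ c n) ≤
        expectedRecourse (rootedStep (κ := Δ + c)) (build ++ relink r₁ r₂ m)
          (Update.insert r₁ r₂) := by
      intro m
      rw [expectedRecourse_rooted_insert hκ hκ2 (hnext m), (hrelink m).2]
      refine hlow _ _ fun i hi => ?_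
      rw [← card_level_of_isCompleteTree ht₂ hi]
      exact Finset.card_le_card (level_subset_update hr₂ i)
    have hunrooted : ∀ (tie : TieRule (Fin n)) (m : ℕ),
        ENNReal.ofReal (1 / 16 * recourseOrder Δ c n) ≤
        expectedRecourse (unrootedStep (κ := Δ + c) Δ tie) (build ++ relink r₁ r₂ m)
          (Update.insert r₁ r₂) := by
      intro tie m
      obtain ⟨par, p, r, hA, hr, hG, -, he⟩ := exists_expectedRecourse_unrooted_insert hκ hκ2 tie
        (legal_of_legalRooted (hnext m)).2.2
      obtain ⟨hg, hG', -⟩ := legal_of_legalRooted (hrelink m).1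
      rw [(hrelink m).2] at hg hG'
      rw [he]
      refine hlow _ _ fun i hi => ?_
      -- both endpoints are roots of complete trees, so that it does not matter which is the child
      have hrt : rootedAfter build r = none ∧ IsCompleteTree (rootedAfter build) (Δ - 1) h r := by
        rcases hr with rfl | rfl
        · exact ⟨hr₁, ht₁⟩
        · exact ⟨hr₂, ht₂⟩
      rw [← card_level_of_isCompleteTree hrt.2 hi]
      exact Finset.card_le_card ((level_subset_of_toGraph_eq hg hA.grounded (hG'.trans hG.symm)
        hrt.1 hA.root i).trans (level_subset_update hA.root i))
    have h3 : 3 * ENNReal.ofReal (1 / 48 * recourseOrder Δ c n) =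
        ENNReal.ofReal (1 / 16 * recourseOrder Δ c n) := by
      rw [show (1 : ℝ) / 16 * recourseOrder Δ c n = 3 * (1 / 48 * recourseOrder Δ c n) by ring,
        ENNReal.ofReal_mul (by norm_num)]
      simp
    have h4 : ENNReal.ofReal (1 / 48 * recourseOrder Δ c n) ≤
        ENNReal.ofReal (1 / 16 * recourseOrder Δ c n) := by
      rw [← h3]
      exact le_mul_of_one_le_left zero_le (by norm_num)
    refine ⟨h, r₁, r₂, build, hne, hr₁, hr₂, ht₁, ht₂, fun m => ⟨(hrelink m).1,
      (legal_of_legalRooted (hrelink m).1).2.2, h4.trans (hrooted m),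
      fun tie => h4.trans (hunrooted tie m)⟩, build.length + 1, fun m hm =>
      ⟨le_amortizedRecourse (fun m => h3.trans_le (hrooted m)) hm,
      fun tie => le_amortizedRecourse (fun m => h3.trans_le (hunrooted tie m)) hm⟩⟩
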